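/- \textbf{Model.} Let $N,L\ge 1$ be integers, $\gamma>0$, and let $\sigma_0,\dots,\sigma_{L-1}\in\mathbb R$ satisfy $\sum_{p=0}^{L-1}\sigma_p^2=1$. Let $H[0],\dots,H[L-1]$ be independent $\mathcal{CN}(0,1)$ random variables (the taps of a single-input single-output Rayleigh-fading channel). The channel on subcarrier $k$ is $$H_k=\sum_{p=0}^{L-1}\sigma_p H[p]\,e^{-2\pi i kp/N},\qquad 0\le k\le N-1,$$ the mutual information of subcarrier $k$ is $\mathcal I_k=\log_2(1+\gamma|H_k|^2)$, and the mutual information of the SISO-OFDM system is $\mathcal I_{\rm ofdm}=\frac1N\sum_{k=0}^{N-1}\mathcal I_k$. For an integer $d$ let $$\rho_d=\sum_{p=0}^{L-1}\sigma_p^2e^{-2\pi i dp/N}.$$ \textbf{Functions.} Let $\mathrm E_h(x)=\int_1^\infty e^{-xt}t^{-h}\,dt$ for $x>0$, and put $g_1(1)=\mathrm E_1(1/\gamma)$ and, for $|\rho_d|<1$ and $z\ge1$, $$g_2(z)=\sum_{h=1}^{z}\mathrm E_h\!\left(\frac{1}{\gamma(1-|\rho_d|^2)}\right).$$ Let $\mathrm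 G$ denote the value of the Meijer $G$-function $$\mathrm G=\mathrm G^{4,0}_{3,4}\!\left(\tfrac1\gamma\,\Big|^{\;0,\,0,\,0}_{0,-1,-1,-1}\right)=\frac1{2\pi i}\int_{c-i\infty}^{c+i\infty}\frac{\Gamma(-s)\,\Gamma(-1-s)^3}{\Gamma(-s)^3}\,\gamma^{-s}\,ds,\qquad c<-1.$$ \textbf{Statement.} One has $E[H_k\overline{H_l}]=\rho_{k-l}$ for $0\le k,l\le N-1$; $|\rho_d|\le1$ for all $d\ge 0$; $\mathcal I_{\rm ofdm}$ is square-integrable; the integral defining $\mathrm G$ converges absolutely and does not depend on $c<-1$; the series below converges whenever $0<|\rho_d|<1$; and $$\operatorname{Var}(\mathcal I_{\rm ofdm})=(\log_2 e)^2\left(\frac{2}{N^2}\sum_{d=1}^{N-1}(N-d)\,\varphi(\rho_d)+\frac{2e^{1/\gamma}}{\gamma N}\,\mathrm G-e^{2/\gamma}\,g_1(1)^2\right),$$ where $$\varphi(\rho_d)=\begin{cases}e^{2/\gamma}\,g_1(1)^2,&|\rho_d|=0,\\[2pt](1-|\rho_d|^2)\,e^{\frac{2}{\gamma(1-|\rho_d|^2)}}\displaystyle\sum_{t=0}^\infty|\rho_d|^{2t}\,g_2(1+t)^2,&0<|\rho_d|<1,\\[6pt]\dfrac{2e^{1/\gamma}}{\gamma}\,\mathrm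 G,&|\rho_d|=1.\end{cases}$$ -/

import Mathlib

open MeasureTheory ProbabilityTheory

noncomputable section

namespace OFDM

/-! ### Special functions -/

/-- The exponential integral `E_h(x) = ∫_1^∞ e^{-x t} / t^h dt` (for `x > 0`). -/
def expIntegralE (h : ℕ) (x : ℝ) : ℝ :=
  ∫ t in Set.Ioi (1 : ℝ), Real.exp (-(x * t)) / t ^ h

/-- The sum `∑_{h=1}^z E_h(x)`. -/
def expIntegralSum (z : ℕ) (x : ℝ) : ℝ :=
  ∑ h ∈ Finset.Icc 1 z, expIntegralE h x

/-- The function `g_1(z) = ∑_{h=1}^z E_h(N_t / γ)`. -/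
def g₁ (Nt : ℕ) (γ : ℝ) (z : ℕ) : ℝ :=
  expIntegralSum z (Nt / γ)

/-- The function `g_2(z) = ∑_{h=1}^z E_h(N_t / (γ (1 - |ρ|²)))`. -/
def g₂ (Nt : ℕ) (γ : ℝ) (ρ : ℂ) (z : ℕ) : ℝ :=
  expIntegralSum z (Nt / (γ * (1 - ‖ρ‖ ^ 2)))

/-- The Mellin-Barnes integrand of the Meijer function `G^{m,n}_{p,q}(x | a ; b)`:
`∏_{j ≤ m} Γ(b_j - s) ∏_{j ≤ n} Γ(1 - a_j + s)
  / (∏_{j > m} Γ(1 - b_j + s) ∏_{j > n} Γ(a_j - s)) * x^s`. -/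
def meijerGIntegrand (m n : ℕ) {p q : ℕ} (a : Fin p → ℂ) (b : Fin q → ℂ) (x s : ℂ) : ℂ :=
  (∏ j : Fin q, if (j : ℕ) < m then Complex.Gamma (b j - s)
      else (Complex.Gamma (1 - b j + s))⁻¹) *
    (∏ j : Fin p, if (j : ℕ) < n then Complex.Gamma (1 - a j + s)
      else (Complex.Gamma (a j - s))⁻¹) *
    x ^ s

/-- The vertical line `Re s = c` separates the poles of the `Γ(b_j - s)`, `j ≤ m` (which lie to its
right) from those of the `Γ(1 - a_j + s)`, `j ≤ n` (which lie to its left). -/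
def IsSeparatingLine (m n : ℕ) {p q : ℕ} (a : Fin p → ℂ) (b : Fin q → ℂ) (c : ℝ) : Prop :=
  (∀ j : Fin q, (j : ℕ) < m → c < (b j).re) ∧ (∀ j : Fin p, (j : ℕ) < n → (a j).re - 1 < c)

/-- The integral `(2πi)⁻¹ ∫ ds` of the Mellin-Barnes integrand along the line `Re s = c`, from
`c - i∞` to `c + i∞`; here `s = c + i t` and `ds = i dt`. -/
def mellinBarnesIntegral (m n : ℕ) {p q : ℕ} (a : Fin p → ℂ) (b : Fin q → ℂ) (x : ℂ) (c : ℝ) : ℂ :=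
  (2 * (Real.pi : ℂ))⁻¹ * ∫ t : ℝ, meijerGIntegrand m n a b x ((c : ℂ) + (t : ℂ) * Complex.I)

open Classical in
/-- The Meijer function `G^{m,n}_{p,q}(x | a ; b)`, as a Mellin-Barnes integral, for parameters whose
two families of poles can be separated by a vertical line (always so for `n = 0`), and in the range
`p + q < 2 (m + n)`, `|arg x| < (m + n - (p + q) / 2) π` in which the integral along such a line
converges absolutely; it does not depend on the separating line. -/
def meijerG (m n : ℕ) {p q : ℕ} (a : Fin p → ℂ) (b : Fin q → ℂ) (x : ℂ) : ℂ :=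
  if h : ∃ c : ℝ, IsSeparatingLine m n a b c then mellinBarnesIntegral m n a b x h.choose else 0

/-- The value `G^{m,n}_{p,q}(x | a ; b)` is well defined: the Mellin-Barnes integral converges
absolutely along every separating line, with one and the same value. -/
def MeijerGWellDefined (m n : ℕ) {p q : ℕ} (a : Fin p → ℂ) (b : Fin q → ℂ) (x : ℂ) : Prop :=
  ∀ c : ℝ, IsSeparatingLine m n a b c →
    Integrable (fun t : ℝ => meijerGIntegrand m n a b x ((c : ℂ) + (t : ℂ) * Complex.I)) ∧
      mellinBarnesIntegral m n a b x c = meijerG m n a b x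

/-! ### The channel model -/

/-- The circularly symmetric complex Gaussian law `CN(0,1)`: real and imaginary parts are
independent, each `N(0, 1/2)`. -/
def stdComplexGaussian : Measure ℂ :=
  ((gaussianReal 0 (1 / 2)).prod (gaussianReal 0 (1 / 2))).map Complex.measurableEquivRealProd.symm

/-- Spatially uncorrelated Rayleigh fading with `L` taps: all entries of all the tap matrices
`H[0], …, H[L-1]` (of size `N_r × N_t`) are mutually independent, each `CN(0,1)`. -/
structure IsRayleighFading {Ω : Type*} [MeasurableSpace Ω] (P : Measure Ω) {L Nr Nt : ℕ}
    (H : Fin L → Ω → Matrix (Fin Nr) (Fin Nt) ℂ) : Prop where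
  hasLaw : ∀ (p : Fin L) (i : Fin Nr) (j : Fin Nt),
    HasLaw (fun ω => H p ω i j) stdComplexGaussian P
  indep : iIndepFun (fun (x : Fin L × Fin Nr × Fin Nt) ω => H x.1 ω x.2.1 x.2.2) P

/-- The `k`-th subcarrier channel matrix `H_k = ∑_p σ_p H[p] exp(-2πi (k/N) p)`. -/
def subcarrierChannel {Ω : Type*} {L Nr Nt : ℕ} (N : ℕ) (σ : Fin L → ℝ)
    (H : Fin L → Ω → Matrix (Fin Nr) (Fin Nt) ℂ) (k : ℕ) (ω : Ω) : Matrix (Fin Nr) (Fin Nt) ℂ :=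
  ∑ p : Fin L,
    ((σ p : ℂ) * Complex.exp (-(2 * Real.pi * Complex.I * ((k : ℂ) / N) * (p : ℕ)))) • H p ω

/-- The frequency correlation coefficient `ρ_d = ∑_p σ_p² exp(-2πi d p / N)`. -/
def freqCorr {L : ℕ} (N : ℕ) (σ : Fin L → ℝ) (d : ℤ) : ℂ :=
  ∑ p : Fin L,
    ((σ p : ℂ) ^ 2) * Complex.exp (-(2 * Real.pi * Complex.I * (d : ℂ) * (p : ℕ) / N))

/-- The mutual information `log₂ det (I + (γ / N_t) H H†)` of a flat channel with matrix `H`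
(the determinant is real). -/
def flatMutualInfo {Nr Nt : ℕ} (γ : ℝ) (H : Matrix (Fin Nr) (Fin Nt) ℂ) : ℝ :=
  Real.logb 2 (1 + ((γ / Nt : ℝ) : ℂ) • (H * H.conjTranspose)).det.re

/-- The mutual information `I_ofdm = N⁻¹ ∑_{k=0}^{N-1} I_k` of the OFDM system. -/
def ofdmMutualInfo {Ω : Type*} {L Nr Nt : ℕ} (N : ℕ) (γ : ℝ) (σ : Fin L → ℝ)
    (H : Fin L → Ω → Matrix (Fin Nr) (Fin Nt) ℂ) (ω : Ω) : ℝ :=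
  (1 / (N : ℝ)) * ∑ k ∈ Finset.range N, flatMutualInfo γ (subcarrierChannel N σ H k ω)

/-! ### The terms of the single-antenna formula -/

/-- The value `G^{4,0}_{3,4}(1/γ | 0,0,0 ; 0,-1,-1,-1)`. -/
def sisoMeijerG (γ : ℝ) : ℂ :=
  meijerG 4 0 ![0, 0, 0] ![0, -1, -1, -1] ((1 / γ : ℝ) : ℂ)

/-- The terms of the infinite series for `0 < |ρ| < 1`. -/
def sisoSeriesTerm (γ : ℝ) (ρ : ℂ) (t : ℕ) : ℝ :=
  ‖ρ‖ ^ (2 * t) * g₂ 1 γ ρ (1 + t) ^ 2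

/-- The function `φ` (for `|ρ| ≤ 1`), defined by cases `|ρ| = 0`, `0 < |ρ| < 1`, `|ρ| = 1`. -/
def sisoPhi (γ : ℝ) (ρ : ℂ) : ℂ :=
  if ‖ρ‖ = 0 then ((Real.exp (2 / γ) * g₁ 1 γ 1 ^ 2 : ℝ) : ℂ)
  else if ‖ρ‖ < 1 then
    (((1 - ‖ρ‖ ^ 2) * Real.exp (2 / (γ * (1 - ‖ρ‖ ^ 2))) *
      ∑' t : ℕ, sisoSeriesTerm γ ρ t : ℝ) : ℂ)
  else ((2 * Real.exp (1 / γ) / γ : ℝ) : ℂ) * sisoMeijerG γ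

end OFDM

end

namespace OFDM

/-! ### Exponential and logarithmic integrals -/

/-! The variance is a double sum of second moments of `log (1 + γ|H_k|²)` minus a squared mean, so
everything rests on the joint law of two subcarriers. Any pair `(H_k, H_l)` is a circular complex
Gaussian pair whose law depends only on `ρ_{k-l}` (`map_pair_eq`). The double sum therefore
collapses to a sum over differences (`sum_sum_range_of_symm`), and the diagonal has `ρ_0 = 1`.

For `|ρ| < 1` the pair of squared moduli is a geometric mixture, over `t`, of independent Gamma
variables of shape `t + 1` (`map_norm_sq_correlatedPair`). Both sides have the same characteristic
function, the mixture side being summed as a geometric series. Conditionally on `t` the mixed moment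
factors into the square of a logarithmic Gamma mean, which integration by parts in the shape
parameter turns into a sum of exponential integrals (`integral_log_gamma`). This produces the series
in `φ`.

For `|ρ| = 1` the two moduli agree, and what remains is the second moment of `log (1 + γV)` with `V`
exponential. The substitution `u = 1 + γv` makes it a Laplace transform of `log²`, evaluated at
`1/γ`. Its Mellin transform is `Γ(w)/(w-1)³`; Mellin inversion and `w = -s` identify it with the
Meijer value (`meijerGWellDefined_siso`). -/

theorem integrableOn_pow_mul_exp_neg (n : ℕ) {r : ℝ} (hr : 0 < r) :
    IntegrableOn (fun t : ℝ => t ^ n * Real.exp (-(r * t))) (Set.Ioi 0) := by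
  by_contra h
  have h1 := Real.integral_rpow_mul_exp_neg_mul_Ioi (a := n + 1) (r := r) (by positivity) hr
  simp only [add_sub_cancel_right, Real.rpow_natCast] at h1
  -- A non-integrable function has integral `0` by convention, whereas the Gamma integral is
  -- positive.
  rw [integral_undef h] at h1
  have : 0 < (1 / r) ^ ((n : ℝ) + 1) * Real.Gamma (n + 1) :=
    mul_pos (by positivity) (Real.Gamma_pos_of_pos (by positivity))
  exact this.ne h1

theorem integrableOn_pow_mul_cexp_neg (n : ℕ) {w : ℂ} (hw : 0 < w.re) :
    IntegrableOn (fun t : ℝ => (t : ℂ) ^ n * Complex.exp (-(w * t))) (Set.Ioi 0) := by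
  refine (integrableOn_pow_mul_exp_neg n hw).mono' (by fun_prop) ?_
  filter_upwards [ae_restrict_mem measurableSet_Ioi] with t ht
  have ht : 0 < t := ht
  simp [Complex.norm_exp, abs_of_pos ht]

theorem tendsto_pow_mul_exp_neg (n : ℕ) {r : ℝ} (hr : 0 < r) :
    Filter.Tendsto (fun t : ℝ => t ^ n * Real.exp (-(r * t))) Filter.atTop (nhds 0) := by
  have := (isLittleO_pow_exp_pos_mul_atTop n hr).tendsto_div_nhds_zero
  simpa [Real.exp_neg, div_eq_mul_inv] using this

theorem integral_pow_mul_cexp_neg (n : ℕ) {w : ℂ} (hw : 0 < w.re) :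
    ∫ t : ℝ in Set.Ioi 0, (t : ℂ) ^ n * Complex.exp (-(w * t)) = n.factorial / w ^ (n + 1) := by
  have hw0 : w ≠ 0 := by rintro rfl; simp at hw
  induction n with
  | zero =>
    have := integral_exp_mul_complex_Ioi (a := -w) (by simpa using hw) 0
    simp only [neg_mul] at this
    simp [this, neg_div_neg_eq]
  | succ n ih =>
    -- Integration by parts: this derivative integrates to zero over the half-line, which links the
    -- exponents `n` and `n + 1`.
    have hd : ∀ t : ℝ, HasDerivAt (fun t : ℝ => (t : ℂ) ^ (n + 1) * Complex.exp (-(w * t)))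
        ((n + 1 : ℂ) * ((t : ℂ) ^ n * Complex.exp (-(w * t)))
          - w * ((t : ℂ) ^ (n + 1) * Complex.exp (-(w * t)))) t := by
      intro t
      have h1 : HasDerivAt (fun t : ℝ => (t : ℂ)) 1 t := Complex.ofRealCLM.hasDerivAt
      convert! (h1.pow (n + 1)).mul ((h1.const_mul w).neg.cexp) using 1
      simp
      ring
    have hi : IntegrableOn (fun t : ℝ => (n + 1 : ℂ) * ((t : ℂ) ^ n * Complex.exp (-(w * t)))
          - w * ((t : ℂ) ^ (n + 1) * Complex.exp (-(w * t)))) (Set.Ioi 0) :=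
      ((integrableOn_pow_mul_cexp_neg n hw).const_mul _).sub
        ((integrableOn_pow_mul_cexp_neg (n + 1) hw).const_mul _)
    have ht : Filter.Tendsto (fun t : ℝ => (t : ℂ) ^ (n + 1) * Complex.exp (-(w * t)))
        Filter.atTop (nhds 0) := by
      rw [tendsto_zero_iff_norm_tendsto_zero]
      refine (tendsto_pow_mul_exp_neg (n + 1) hw).congr' ?_
      filter_upwards [Filter.eventually_gt_atTop 0] with t ht
      simp [Complex.norm_exp, abs_of_pos ht]
    have key := integral_Ioi_of_hasDerivAt_of_tendsto (a := 0)
      (hd 0).continuousAt.continuousWithinAt (fun t _ => hd t) hi ht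
    rw [integral_sub ((integrableOn_pow_mul_cexp_neg n hw).const_mul _)
      ((integrableOn_pow_mul_cexp_neg (n + 1) hw).const_mul _), integral_const_mul,
      integral_const_mul, ih] at key
    simp only [Complex.ofReal_zero, ne_eq, Nat.add_eq_zero_iff, one_ne_zero, and_false,
      not_false_eq_true, zero_pow, zero_mul, sub_zero] at key
    rw [Nat.factorial_succ]
    push_cast
    rw [eq_div_iff (pow_ne_zero _ hw0)]
    have h2 := eq_of_sub_eq_zero key
    rw [pow_succ, mul_comm (w ^ (n + 1)) w, ← mul_assoc, mul_comm _ w, ← h2]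
    field_simp

theorem image_exp_Ioi_zero : Real.exp '' Set.Ioi 0 = Set.Ioi 1 := by
  ext u
  constructor
  · rintro ⟨v, hv, rfl⟩
    exact Real.one_lt_exp_iff.2 hv
  · intro hu
    exact ⟨Real.log u, Real.log_pos hu, Real.exp_log (zero_lt_one.trans hu)⟩

/-- This is the integrand after the substitution `u = e^v`; the Jacobian `e^v` shifts `w` to `w -
1`. -/
theorem exp_smul_log_pow_mul_cpow (n : ℕ) (w : ℂ) (v : ℝ) :
    |Real.exp v| • ((Real.log (Real.exp v) : ℂ) ^ n * (Real.exp v : ℂ) ^ (-w)) =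
      (v : ℂ) ^ n * Complex.exp (-((w - 1) * v)) := by
  rw [Real.log_exp, Complex.cpow_def_of_ne_zero (by exact_mod_cast (Real.exp_pos v).ne'),
    ← Complex.ofReal_log (Real.exp_pos v).le, Real.log_exp, abs_of_pos (Real.exp_pos v),
    Complex.real_smul, Complex.ofReal_exp, mul_left_comm, ← Complex.exp_add]
  ring_nf

theorem integrableOn_log_pow_mul_cpow (n : ℕ) {w : ℂ} (hw : 1 < w.re) :
    IntegrableOn (fun u : ℝ => (Real.log u : ℂ) ^ n * (u : ℂ) ^ (-w)) (Set.Ioi 1) := by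
  rw [← image_exp_Ioi_zero, integrableOn_image_iff_integrableOn_abs_deriv_smul measurableSet_Ioi
    (fun x _ => (Real.hasDerivAt_exp x).hasDerivWithinAt) Real.exp_injective.injOn]
  simp_rw [exp_smul_log_pow_mul_cpow]
  exact integrableOn_pow_mul_cexp_neg n (by simpa using hw)

theorem integral_log_pow_mul_cpow (n : ℕ) {w : ℂ} (hw : 1 < w.re) :
    ∫ u : ℝ in Set.Ioi 1, (Real.log u : ℂ) ^ n * (u : ℂ) ^ (-w) =
      n.factorial / (w - 1) ^ (n + 1) := by
  rw [← image_exp_Ioi_zero, integral_image_eq_integral_abs_deriv_smul measurableSet_Ioi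
    (fun x _ => (Real.hasDerivAt_exp x).hasDerivWithinAt) Real.exp_injective.injOn]
  simp_rw [exp_smul_log_pow_mul_cpow]
  exact integral_pow_mul_cexp_neg n (by simpa using hw)

/-! ### The Meijer function as a Laplace transform of `log²` -/

/-- The function `y ↦ (1/2) ∫_1^∞ log² u e^{-y u} du`. -/
noncomputable def logSqLaplace (y : ℝ) : ℝ :=
  (1 / 2) * ∫ u in Set.Ioi (1 : ℝ), Real.log u ^ 2 * Real.exp (-(y * u))

theorem integrableOn_log_sq_mul_exp_neg {y : ℝ} (hy : 0 < y) :
    IntegrableOn (fun u : ℝ => Real.log u ^ 2 * Real.exp (-(y * u))) (Set.Ioi 1) := by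
  refine ((integrableOn_pow_mul_exp_neg 2 hy).mono_set
    (Set.Ioi_subset_Ioi zero_le_one)).mono' (by fun_prop) ?_
  filter_upwards [ae_restrict_mem measurableSet_Ioi] with u hu
  have hu : 1 < u := hu
  have h0 := Real.log_nonneg hu.le
  have h1 := Real.log_le_sub_one_of_pos (zero_lt_one.trans hu)
  rw [norm_mul, Real.norm_of_nonneg (sq_nonneg _), Real.norm_of_nonneg (Real.exp_pos _).le]
  gcongr
  linarith

/-- Mellin inversion recovers a function only at its points of continuity. Near `y` the kernel is
dominated by the one at `y / 2`. -/
theorem continuousAt_logSqLaplace {y : ℝ} (hy : 0 < y) : ContinuousAt logSqLaplace y := by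
  refine continuousAt_const.mul (continuousAt_of_dominated
    (bound := fun u : ℝ => Real.log u ^ 2 * Real.exp (-(y / 2 * u))) ?_ ?_
    (integrableOn_log_sq_mul_exp_neg (half_pos hy)) ?_)
  · exact Filter.Eventually.of_forall fun x => by fun_prop
  · filter_upwards [lt_mem_nhds (half_lt_self hy)] with x hx
    filter_upwards [ae_restrict_mem measurableSet_Ioi] with u hu
    have hu : 1 < u := hu
    rw [norm_mul, Real.norm_of_nonneg (sq_nonneg _), Real.norm_of_nonneg (Real.exp_pos _).le]
    gcongr
  · exact Filter.Eventually.of_forall fun u => by fun_prop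

theorem integrable_logSq_mellin_kernel {w : ℂ} (hw : 1 < w.re) :
    Integrable (fun z : ℝ × ℝ => (z.1 : ℂ) ^ (w - 1) *
        ((Real.log z.2 : ℂ) ^ 2 * Complex.exp (-(z.2 * z.1 : ℝ))))
      ((volume.restrict (Set.Ioi 0)).prod (volume.restrict (Set.Ioi 1))) := by
  have hm : AEStronglyMeasurable (fun z : ℝ × ℝ => (z.1 : ℂ) ^ (w - 1) *
        ((Real.log z.2 : ℂ) ^ 2 * Complex.exp (-(z.2 * z.1 : ℝ))))
      ((volume.restrict (Set.Ioi 0)).prod (volume.restrict (Set.Ioi 1))) := by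
    apply Measurable.aestronglyMeasurable
    fun_prop
  have hw0 : 0 < w.re := zero_lt_one.trans hw
  rw [integrable_prod_iff' hm]
  constructor
  · filter_upwards [ae_restrict_mem measurableSet_Ioi] with u hu
    have hu : 1 < u := hu
    have hu0 : 0 < u := zero_lt_one.trans hu
    by_contra h
    have h1 := Complex.integral_cpow_mul_exp_neg_mul_Ioi hw0 hu0
    rw [integral_undef] at h1
    · have h2 : (1 / (u : ℂ)) ^ w * Complex.Gamma w ≠ 0 :=
        mul_ne_zero (by simp [Complex.cpow_eq_zero_iff, hu0.ne'])
          (Complex.Gamma_ne_zero_of_re_pos hw0)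
      exact h2 h1.symm
    · intro h3
      refine h ((h3.mul_const ((Real.log u : ℂ) ^ 2)).congr ?_)
      filter_upwards with t
      push_cast
      ring
  · have h2 := (integrableOn_log_pow_mul_cpow 2 hw).norm.const_mul (Real.Gamma w.re)
    refine h2.congr ?_
    filter_upwards [ae_restrict_mem measurableSet_Ioi] with u hu
    have hu : 1 < u := hu
    have hu0 : 0 < u := zero_lt_one.trans hu
    have h1 := Real.integral_rpow_mul_exp_neg_mul_Ioi hw0 hu0
    have h3 : ∫ t in Set.Ioi (0 : ℝ), ‖(t : ℂ) ^ (w - 1) *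
        ((Real.log u : ℂ) ^ 2 * Complex.exp (-(u * t : ℝ)))‖ =
        ∫ t in Set.Ioi (0 : ℝ), Real.log u ^ 2 * (t ^ (w.re - 1) * Real.exp (-(u * t))) := by
      refine setIntegral_congr_fun measurableSet_Ioi fun t ht => ?_
      have ht : 0 < t := ht
      simp only [norm_mul, Complex.norm_cpow_eq_rpow_re_of_pos ht, norm_pow, Complex.norm_real,
        Complex.norm_exp, Real.norm_eq_abs, sq_abs]
      simp
      ring
    rw [h3, integral_const_mul, h1]
    simp only [norm_mul, Complex.norm_cpow_eq_rpow_re_of_pos hu0, norm_pow, Complex.norm_real,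
      Real.norm_eq_abs, sq_abs, Complex.neg_re, Real.rpow_neg hu0.le, one_div,
      Real.inv_rpow hu0.le]
    ring

theorem ofReal_logSqLaplace (y : ℝ) : (logSqLaplace y : ℂ) =
    (1 / 2) * ∫ u in Set.Ioi (1 : ℝ), (Real.log u : ℂ) ^ 2 * Complex.exp (-(u * y : ℝ)) := by
  rw [logSqLaplace]
  push_cast
  rw [← integral_complex_ofReal]
  congr 2
  ext u
  push_cast
  ring_nf

theorem mellinConvergent_logSqLaplace {w : ℂ} (hw : 1 < w.re) :
    MellinConvergent (fun y => (logSqLaplace y : ℂ)) w := by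
  have h := (integrable_logSq_mellin_kernel hw).integral_prod_left.const_mul (1 / 2)
  refine h.congr ?_
  filter_upwards with y
  rw [integral_const_mul, ofReal_logSqLaplace, smul_eq_mul]
  ring

/-- After Fubini the inner integral in `y` is `Γ(w) u^{-w}`, and the integral of `log² u · u^{-w}`
is `2/(w-1)³`. The factor `1/2` in `logSqLaplace` cancels this `2`. -/
theorem mellin_logSqLaplace {w : ℂ} (hw : 1 < w.re) :
    mellin (fun y => (logSqLaplace y : ℂ)) w = Complex.Gamma w / (w - 1) ^ 3 := by
  have hw0 : 0 < w.re := zero_lt_one.trans hw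
  have h1 : mellin (fun y => (logSqLaplace y : ℂ)) w = (1 / 2) * ∫ y in Set.Ioi (0 : ℝ),
      ∫ u in Set.Ioi (1 : ℝ), (y : ℂ) ^ (w - 1) *
        ((Real.log u : ℂ) ^ 2 * Complex.exp (-(u * y : ℝ))) := by
    rw [mellin, ← integral_const_mul]
    congr 1
    ext y
    rw [integral_const_mul, ofReal_logSqLaplace, smul_eq_mul]
    ring
  have h2 : ∀ u ∈ Set.Ioi (1 : ℝ), ∫ y in Set.Ioi (0 : ℝ), (y : ℂ) ^ (w - 1) *
        ((Real.log u : ℂ) ^ 2 * Complex.exp (-(u * y : ℝ))) =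
      Complex.Gamma w * ((Real.log u : ℂ) ^ 2 * (u : ℂ) ^ (-w)) := by
    intro u hu
    have hu0 : (0 : ℝ) < u := zero_lt_one.trans hu
    have h := Complex.integral_cpow_mul_exp_neg_mul_Ioi hw0 hu0
    simp_rw [mul_left_comm _ ((Real.log u : ℂ) ^ 2)]
    rw [integral_const_mul]
    push_cast
    rw [h, one_div, Complex.inv_cpow _ _ (by
      rw [Complex.arg_ofReal_of_nonneg hu0.le]; exact Real.pi_pos.ne), Complex.cpow_neg]
    ring
  rw [h1, integral_integral_swap (f := fun y u : ℝ => (y : ℂ) ^ (w - 1) *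
        ((Real.log u : ℂ) ^ 2 * Complex.exp (-(u * y : ℝ)))) (integrable_logSq_mellin_kernel hw),
    setIntegral_congr_fun measurableSet_Ioi h2, integral_const_mul,
    integral_log_pow_mul_cpow 2 hw]
  simp [Nat.factorial]
  ring

/-- Boundedness of `Γ` on vertical lines is enough: the cubic denominator alone supplies the decay,
so no Stirling estimate is needed. -/
theorem norm_Gamma_le {w : ℂ} (hw : 0 < w.re) : ‖Complex.Gamma w‖ ≤ Real.Gamma w.re := by
  rw [Complex.Gamma_eq_integral hw, Real.Gamma_eq_integral hw, Complex.GammaIntegral]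
  refine (norm_integral_le_integral_norm _).trans_eq
    (setIntegral_congr_fun measurableSet_Ioi fun t ht => ?_)
  have ht : 0 < t := ht
  simp [Complex.norm_cpow_eq_rpow_re_of_pos ht, -Complex.ofReal_exp,
    abs_of_pos (Real.exp_pos _)]

theorem verticalIntegrable_Gamma_div_cube {s : ℝ} (hs : 1 < s) :
    Complex.VerticalIntegrable (fun w => Complex.Gamma w / (w - 1) ^ 3) s := by
  set δ := s - 1 with hδ
  have hδ0 : 0 < δ := sub_pos.2 hs
  have hb : Integrable (fun t : ℝ => Real.Gamma s / δ ^ 3 * (1 + (δ⁻¹ * t) ^ 2)⁻¹) :=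
    (integrable_inv_one_add_sq.comp_mul_left' (inv_ne_zero hδ0.ne')).const_mul _
  have hc : Continuous fun t : ℝ => Complex.Gamma (s + t * Complex.I) /
      (s + t * Complex.I - 1) ^ 3 := by
    rw [continuous_iff_continuousAt]
    intro t
    have hre : ((s : ℂ) + t * Complex.I).re = s := by simp
    refine ContinuousAt.div ?_ (by fun_prop) ?_
    · refine ContinuousAt.comp (g := Complex.Gamma)
        (Complex.differentiableAt_Gamma _ fun m h => ?_).continuousAt (by fun_prop)
      have := congrArg Complex.re h
      rw [hre] at this
      simp at this
      have hm : (0 : ℝ) ≤ m := m.cast_nonneg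
      linarith
    · refine pow_ne_zero _ fun h => ?_
      have := congrArg Complex.re h
      simp at this
      linarith
  refine hb.mono' hc.aestronglyMeasurable (Filter.Eventually.of_forall fun t => ?_)
  have hre : ((s : ℂ) + t * Complex.I).re = s := by simp
  have h1 := norm_Gamma_le (w := (s : ℂ) + t * Complex.I) (by rw [hre]; linarith)
  rw [hre] at h1
  set z : ℂ := (s : ℂ) + t * Complex.I - 1 with hz
  have h2 : ‖z‖ ^ 2 = δ ^ 2 + t ^ 2 := by
    rw [← Complex.normSq_eq_norm_sq, Complex.normSq_apply, hz]
    simp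
    ring
  have h3 : δ ≤ ‖z‖ := abs_le_of_sq_le_sq' (by rw [h2]; nlinarith [sq_nonneg t])
    (norm_nonneg _) |>.2
  rw [norm_div, norm_pow]
  -- One factor `‖z‖` is bounded below by `δ`; the other two give the integrable Cauchy weight.
  have h4 : δ ^ 3 * (1 + (δ⁻¹ * t) ^ 2) ≤ ‖z‖ ^ 3 := by
    have : δ ^ 3 * (1 + (δ⁻¹ * t) ^ 2) = δ * ‖z‖ ^ 2 := by
      rw [h2]
      field_simp
    calc δ ^ 3 * (1 + (δ⁻¹ * t) ^ 2) = δ * ‖z‖ ^ 2 := this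
      _ ≤ ‖z‖ * ‖z‖ ^ 2 := by gcongr
      _ = ‖z‖ ^ 3 := by ring
  calc ‖Complex.Gamma (s + t * Complex.I)‖ / ‖z‖ ^ 3
      ≤ Real.Gamma s / (δ ^ 3 * (1 + (δ⁻¹ * t) ^ 2)) := by
        gcongr
    _ = _ := by rw [div_mul_eq_div_mul_one_div, one_div]

theorem mellinInv_Gamma_div_cube {s x : ℝ} (hs : 1 < s) (hx : 0 < x) :
    mellinInv s (fun w => Complex.Gamma w / (w - 1) ^ 3) x = (logSqLaplace x : ℂ) := by
  have hre : ∀ t : ℝ, ((s : ℂ) + t * Complex.I).re = s := fun t => by simp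
  have hv : ∀ t : ℝ, mellin (fun y => (logSqLaplace y : ℂ)) (s + t * Complex.I) =
      Complex.Gamma (s + t * Complex.I) / (s + t * Complex.I - 1) ^ 3 := fun t =>
    mellin_logSqLaplace (by rwa [hre])
  rw [← mellinInv_mellin_eq s (fun y => (logSqLaplace y : ℂ)) hx
    (mellinConvergent_logSqLaplace (by simpa using hs))]
  · simp_rw [mellinInv, hv]
  · have := verticalIntegrable_Gamma_div_cube hs
    simpa only [Complex.VerticalIntegrable, hv] using this
  · exact Complex.continuous_ofReal.continuousAt.comp (continuousAt_logSqLaplace hx)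

/-- Since `Γ(-s) = (-s-1) Γ(-1-s)`, each of the three quotients `Γ(-1-s)/Γ(-s)` is `1/(-s-1)`, and a
single `Γ(-s)` survives. -/
theorem meijerGIntegrand_siso (x : ℝ) {s : ℂ} (hs : s.re < -1) :
    meijerGIntegrand 4 0 (![0, 0, 0] : Fin 3 → ℂ) ![0, -1, -1, -1] x s =
      (x : ℂ) ^ s * (Complex.Gamma (-s) / (-s - 1) ^ 3) := by
  have h0 : Complex.Gamma (-s) ≠ 0 := Complex.Gamma_ne_zero_of_re_pos (by simp; linarith)
  have h1 : -s - 1 ≠ 0 := fun h => by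
    have := congrArg Complex.re h
    simp at this
    linarith
  have h2 : Complex.Gamma (-s) = (-s - 1) * Complex.Gamma (-1 - s) := by
    rw [← sub_add_cancel (-s) 1, Complex.Gamma_add_one _ h1]
    ring_nf
  have h3 : Complex.Gamma (-1 - s) = Complex.Gamma (-s) / (-s - 1) := by
    rw [h2]; field_simp
  have : meijerGIntegrand 4 0 (![0, 0, 0] : Fin 3 → ℂ) ![0, -1, -1, -1] x s =
      (Complex.Gamma (-s) * Complex.Gamma (-1 - s) ^ 3) * (Complex.Gamma (-s))⁻¹ ^ 3 *
        (x : ℂ) ^ s := by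
    simp [meijerGIntegrand, Fin.prod_univ_succ, -mul_eq_mul_right_iff]
    ring
  rw [this, h3]
  field_simp

theorem isSeparatingLine_siso_iff {c : ℝ} :
    IsSeparatingLine 4 0 (![0, 0, 0] : Fin 3 → ℂ) ![0, -1, -1, -1] c ↔ c < -1 := by
  simp [IsSeparatingLine, Fin.forall_fin_succ]
  intro h
  linarith

theorem mellinBarnes_siso {x c : ℝ} (hx : 0 < x) (hc : c < -1) :
    Integrable (fun t : ℝ => meijerGIntegrand 4 0 (![0, 0, 0] : Fin 3 → ℂ) ![0, -1, -1, -1] x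
      ((c : ℂ) + (t : ℂ) * Complex.I)) ∧
    mellinBarnesIntegral 4 0 (![0, 0, 0] : Fin 3 → ℂ) ![0, -1, -1, -1] x c = logSqLaplace x := by
  set F : ℝ → ℂ := fun t => (x : ℂ) ^ (-((-c : ℝ) + (t : ℂ) * Complex.I)) *
    (Complex.Gamma ((-c : ℝ) + t * Complex.I) / ((-c : ℝ) + t * Complex.I - 1) ^ 3) with hF
  -- The change `w = -s` sends the line `Re s = c` to `Re w = -c > 1` and reverses its orientation.
  have hI : (fun t : ℝ => meijerGIntegrand 4 0 (![0, 0, 0] : Fin 3 → ℂ) ![0, -1, -1, -1] x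
      ((c : ℂ) + (t : ℂ) * Complex.I)) = fun t => F (-t) := by
    ext t
    rw [meijerGIntegrand_siso x (by simpa using hc)]
    simp only [hF]
    push_cast
    ring_nf
  have hs : 1 < -c := by linarith
  have hFi : Integrable F := by
    have h := (verticalIntegrable_Gamma_div_cube hs).norm.const_mul (x ^ c)
    refine h.mono' ?_ ?_
    · refine AEStronglyMeasurable.mul ?_ (verticalIntegrable_Gamma_div_cube hs).1
      apply Measurable.aestronglyMeasurable
      fun_prop
    · filter_upwards with t
      rw [norm_mul, Complex.norm_cpow_eq_rpow_re_of_pos hx]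
      simp
  constructor
  · rw [hI]
    exact hFi.comp_neg
  · rw [mellinBarnesIntegral, hI, integral_neg_eq_self F volume, ← mellinInv_Gamma_div_cube hs hx,
      mellinInv, Complex.real_smul]
    simp [hF]

theorem meijerGWellDefined_siso {x : ℝ} (hx : 0 < x) :
    MeijerGWellDefined 4 0 (![0, 0, 0] : Fin 3 → ℂ) ![0, -1, -1, -1] x ∧
      meijerG 4 0 (![0, 0, 0] : Fin 3 → ℂ) ![0, -1, -1, -1] x = logSqLaplace x := by
  have h : ∃ c : ℝ, IsSeparatingLine 4 0 (![0, 0, 0] : Fin 3 → ℂ) ![0, -1, -1, -1] c :=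
    ⟨-2, isSeparatingLine_siso_iff.2 (by norm_num)⟩
  have hG : meijerG 4 0 (![0, 0, 0] : Fin 3 → ℂ) ![0, -1, -1, -1] x = logSqLaplace x := by
    -- Nothing is known about the chosen line except that it separates; every such line gives the
    -- same value.
    rw [meijerG, dif_pos h]
    exact (mellinBarnes_siso hx (isSeparatingLine_siso_iff.1 h.choose_spec)).2
  refine ⟨fun c hc => ?_, hG⟩
  rw [hG]
  exact mellinBarnes_siso hx (isSeparatingLine_siso_iff.1 hc)

/-! ### Logarithmic moments of Gamma laws -/

theorem integral_pow_mul_exp_neg (n : ℕ) {r : ℝ} (hr : 0 < r) :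
    ∫ t in Set.Ioi (0 : ℝ), t ^ n * Real.exp (-(r * t)) = n.factorial / r ^ (n + 1) := by
  have h := Real.integral_rpow_mul_exp_neg_mul_Ioi (a := n + 1) (by positivity) hr
  simp only [add_sub_cancel_right, Real.rpow_natCast, Real.Gamma_nat_eq_factorial] at h
  rw [h, ← Nat.cast_add_one, Real.rpow_natCast, one_div, inv_pow]
  ring

theorem integrableOn_exp_neg_mul_Ioi_one {x : ℝ} (hx : 0 < x) :
    IntegrableOn (fun u : ℝ => Real.exp (-(x * u))) (Set.Ioi 1) := by
  simpa using (integrableOn_pow_mul_exp_neg 0 hx).mono_set (Set.Ioi_subset_Ioi zero_le_one)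

theorem integral_exp_neg_mul_Ioi_one {x : ℝ} (hx : 0 < x) :
    ∫ u in Set.Ioi (1 : ℝ), Real.exp (-(x * u)) = Real.exp (-x) / x := by
  have := integral_exp_mul_Ioi (a := -x) (by linarith) 1
  simp only [neg_mul, mul_one] at this
  rw [this, neg_div_neg_eq]

theorem integrable_expIntegral_kernel (n : ℕ) {x R : ℝ} (hx : 0 < x) (hR : 0 < R) :
    Integrable (fun z : ℝ × ℝ => z.1 ^ n * Real.exp (-(x * z.2 + R * z.2 * z.1)))
      ((volume.restrict (Set.Ioi 0)).prod (volume.restrict (Set.Ioi 1))) := by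
  rw [integrable_prod_iff' (by fun_prop)]
  constructor
  · filter_upwards [ae_restrict_mem measurableSet_Ioi] with u hu
    have hu0 : (0 : ℝ) < u := zero_lt_one.trans hu
    refine ((integrableOn_pow_mul_exp_neg n (mul_pos hR hu0)).mul_const
      (Real.exp (-(x * u)))).congr ?_
    filter_upwards with v
    rw [mul_assoc, ← Real.exp_add]
    ring_nf
  · have hd : IntegrableOn (fun u : ℝ => n.factorial / R ^ (n + 1) * Real.exp (-(x * u)))
        (Set.Ioi 1) := (integrableOn_exp_neg_mul_Ioi_one hx).const_mul _
    refine hd.mono' ?_ ?_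
    · refine AEStronglyMeasurable.integral_prod_right'
        (f := fun z : ℝ × ℝ => ‖z.2 ^ n * Real.exp (-(x * z.1 + R * z.1 * z.2))‖) (by fun_prop)
    · filter_upwards [ae_restrict_mem measurableSet_Ioi] with u hu
      have hu : 1 < u := hu
      have hu0 : (0 : ℝ) < u := zero_lt_one.trans hu
      have : ∫ v in Set.Ioi (0 : ℝ), ‖v ^ n * Real.exp (-(x * u + R * u * v))‖ =
          ∫ v in Set.Ioi (0 : ℝ), Real.exp (-(x * u)) * (v ^ n * Real.exp (-(R * u * v))) := by
        refine setIntegral_congr_fun measurableSet_Ioi fun v hv => ?_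
        have hv : 0 < v := hv
        rw [Real.norm_of_nonneg (by positivity), neg_add, Real.exp_add]
        ring
      rw [this, integral_const_mul, integral_pow_mul_exp_neg n (mul_pos hR hu0),
        Real.norm_of_nonneg (by positivity), mul_comm]
      gcongr
      nlinarith

/-- Fubini for `v^n e^{-(xu + Ruv)}` with `x = R/γ`. Integrating over `u > 1` creates the factor
`γ/(1 + γv)`, while integrating over `v > 0` leaves `e^{-xu}/u^{n+1}`, the integrand of
`E_{n+1}(x)`. -/
theorem integral_pow_mul_exp_neg_mul_div (n : ℕ) {γ R : ℝ} (hγ : 0 < γ) (hR : 0 < R) :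
    ∫ v in Set.Ioi (0 : ℝ), v ^ n * Real.exp (-(R * v)) * (γ / (1 + γ * v)) =
      n.factorial / R ^ n * (Real.exp (R / γ) * expIntegralE (n + 1) (R / γ)) := by
  set x := R / γ with hx
  have hx0 : 0 < x := div_pos hR hγ
  have hsw := integral_integral_swap (f := fun v u : ℝ =>
    v ^ n * Real.exp (-(x * u + R * u * v))) (integrable_expIntegral_kernel n hx0 hR)
  have h1 : ∀ v ∈ Set.Ioi (0 : ℝ), ∫ u in Set.Ioi (1 : ℝ),
      v ^ n * Real.exp (-(x * u + R * u * v)) =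
      (Real.exp (-x) / R) * (v ^ n * Real.exp (-(R * v)) * (γ / (1 + γ * v))) := by
    intro v hv
    have hv : 0 < v := hv
    have h2 : ∀ u : ℝ, x * u + R * u * v = (x + R * v) * u := fun u => by ring
    simp_rw [h2]
    rw [integral_const_mul, integral_exp_neg_mul_Ioi_one (by positivity), neg_add, Real.exp_add,
      hx]
    field_simp
  have h3 : ∀ u ∈ Set.Ioi (1 : ℝ), ∫ v in Set.Ioi (0 : ℝ),
      v ^ n * Real.exp (-(x * u + R * u * v)) =
      (n.factorial / R ^ (n + 1)) * (Real.exp (-(x * u)) / u ^ (n + 1)) := by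
    intro u hu
    have hu0 : (0 : ℝ) < u := zero_lt_one.trans hu
    have h4 : ∀ v : ℝ, v ^ n * Real.exp (-(x * u + R * u * v)) =
        Real.exp (-(x * u)) * (v ^ n * Real.exp (-(R * u * v))) := fun v => by
      rw [neg_add, Real.exp_add]; ring
    simp_rw [h4]
    rw [integral_const_mul, integral_pow_mul_exp_neg n (mul_pos hR hu0), mul_pow]
    field_simp
  rw [setIntegral_congr_fun measurableSet_Ioi h1, setIntegral_congr_fun measurableSet_Ioi h3,
    integral_const_mul, integral_const_mul] at hsw
  rw [expIntegralE]
  rw [div_mul_eq_mul_div, div_eq_iff hR.ne', Real.exp_neg, inv_mul_eq_iff_eq_mul₀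
    (Real.exp_pos x).ne'] at hsw
  rw [hsw, pow_succ]
  field_simp

theorem abs_log_one_add_mul_le {γ v : ℝ} (hγ : 0 ≤ γ) (hv : 0 ≤ v) :
    |Real.log (1 + γ * v)| ≤ γ * v := by
  have h0 : 0 ≤ γ * v := mul_nonneg hγ hv
  rw [abs_of_nonneg (Real.log_nonneg (by linarith))]
  have := Real.log_le_sub_one_of_pos (show 0 < 1 + γ * v by linarith)
  linarith

theorem integrableOn_pow_mul_exp_neg_mul_log (n k : ℕ) {γ R : ℝ} (hγ : 0 < γ) (hR : 0 < R) :
    IntegrableOn (fun v : ℝ => v ^ n * Real.exp (-(R * v)) * Real.log (1 + γ * v) ^ k)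
      (Set.Ioi 0) := by
  refine ((integrableOn_pow_mul_exp_neg (n + k) hR).const_mul (γ ^ k)).mono' (by fun_prop) ?_
  filter_upwards [ae_restrict_mem measurableSet_Ioi] with v hv
  have hv : 0 < v := hv
  rw [norm_mul, norm_pow, Real.norm_of_nonneg (by positivity), Real.norm_eq_abs]
  calc v ^ n * Real.exp (-(R * v)) * |Real.log (1 + γ * v)| ^ k
      ≤ v ^ n * Real.exp (-(R * v)) * (γ * v) ^ k := by
        gcongr
        exact abs_log_one_add_mul_le hγ.le hv.le
    _ = _ := by rw [mul_pow, pow_add]; ring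

/-- For `n = 0` the truncated exponent `n - 1` is harmless, because its coefficient `n` vanishes. -/
theorem hasDerivAt_pow_mul_exp_neg_mul_log (n : ℕ) {γ R v : ℝ} (hγ : 0 < γ) (hv : 0 ≤ v) :
    HasDerivAt (fun v : ℝ => v ^ n * Real.exp (-(R * v)) * Real.log (1 + γ * v))
      (v ^ n * Real.exp (-(R * v)) * (γ / (1 + γ * v))
        + (n * (v ^ (n - 1) * Real.exp (-(R * v)) * Real.log (1 + γ * v))
        - R * (v ^ n * Real.exp (-(R * v)) * Real.log (1 + γ * v)))) v := by
  have h0 : 1 + γ * v ≠ 0 := by positivity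
  have h1 : HasDerivAt (fun v : ℝ => Real.exp (-(R * v))) (Real.exp (-(R * v)) * (-(R * 1))) v :=
    ((hasDerivAt_id v).const_mul R).neg.exp
  have h2 : HasDerivAt (fun v : ℝ => Real.log (1 + γ * v)) (γ * 1 / (1 + γ * v)) v :=
    (((hasDerivAt_id v).const_mul γ).const_add 1).log h0
  convert! ((hasDerivAt_pow n v).mul h1).mul h2 using 1
  simp only [Pi.mul_apply]
  ring

/-- Integration by parts. The boundary term at `0` vanishes because `log 1 = 0`, the one at infinity
because of the exponential. -/
theorem mul_integral_log (n : ℕ) {γ R : ℝ} (hγ : 0 < γ) (hR : 0 < R) :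
    R * ∫ v in Set.Ioi (0 : ℝ), v ^ n * Real.exp (-(R * v)) * Real.log (1 + γ * v) =
      (n * ∫ v in Set.Ioi (0 : ℝ), v ^ (n - 1) * Real.exp (-(R * v)) * Real.log (1 + γ * v)) +
      n.factorial / R ^ n * (Real.exp (R / γ) * expIntegralE (n + 1) (R / γ)) := by
  have hi : ∀ m : ℕ, IntegrableOn (fun v : ℝ =>
      v ^ m * Real.exp (-(R * v)) * Real.log (1 + γ * v)) (Set.Ioi 0) := fun m => by
    simpa using integrableOn_pow_mul_exp_neg_mul_log m 1 hγ hR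
  have hk : IntegrableOn (fun v : ℝ => v ^ n * Real.exp (-(R * v)) * (γ / (1 + γ * v)))
      (Set.Ioi 0) := by
    refine ((integrableOn_pow_mul_exp_neg n hR).mul_const γ).mono' (by fun_prop) ?_
    filter_upwards [ae_restrict_mem measurableSet_Ioi] with v hv
    have hv : 0 < v := hv
    rw [Real.norm_of_nonneg (by positivity)]
    gcongr
    exact div_le_self hγ.le (by nlinarith)
  have ht : Filter.Tendsto (fun v : ℝ => v ^ n * Real.exp (-(R * v)) * Real.log (1 + γ * v))
      Filter.atTop (nhds 0) := by
    have h := (tendsto_pow_mul_exp_neg (n + 1) hR).const_mul γ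
    rw [mul_zero] at h
    refine squeeze_zero_norm' ?_ h
    filter_upwards [Filter.eventually_gt_atTop 0] with v hv
    rw [norm_mul, Real.norm_of_nonneg (by positivity), Real.norm_eq_abs]
    calc v ^ n * Real.exp (-(R * v)) * |Real.log (1 + γ * v)|
        ≤ v ^ n * Real.exp (-(R * v)) * (γ * v) := by
          gcongr
          exact abs_log_one_add_mul_le hγ.le hv.le
      _ = _ := by rw [pow_succ]; ring
  have hs : IntegrableOn (fun v : ℝ =>
      n * (v ^ (n - 1) * Real.exp (-(R * v)) * Real.log (1 + γ * v))
        - R * (v ^ n * Real.exp (-(R * v)) * Real.log (1 + γ * v))) (Set.Ioi 0) :=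
    ((hi (n - 1)).const_mul _).sub ((hi n).const_mul _)
  have key := integral_Ioi_of_hasDerivAt_of_tendsto (a := 0)
    (hasDerivAt_pow_mul_exp_neg_mul_log n (R := R) hγ le_rfl).continuousAt.continuousWithinAt
    (fun v hv => hasDerivAt_pow_mul_exp_neg_mul_log n hγ (le_of_lt hv))
    (hk.add hs) ht
  rw [integral_add hk hs,
    integral_sub ((hi (n - 1)).const_mul _) ((hi n).const_mul _), integral_const_mul,
    integral_const_mul, integral_pow_mul_exp_neg_mul_div n hγ hR] at key
  simp only [mul_zero, add_zero, Real.log_one, sub_zero] at key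
  linarith

/-- The prefactor normalises the Gamma density. Raising the shape by one adds exactly one
exponential integral to the mean. -/
theorem integral_log_gamma (n : ℕ) {γ R : ℝ} (hγ : 0 < γ) (hR : 0 < R) :
    R ^ (n + 1) / n.factorial *
      ∫ v in Set.Ioi (0 : ℝ), v ^ n * Real.exp (-(R * v)) * Real.log (1 + γ * v) =
      Real.exp (R / γ) * expIntegralSum (n + 1) (R / γ) := by
  induction n with
  | zero =>
    have h := mul_integral_log 0 hγ hR
    simpa [expIntegralSum] using h
  | succ n ih =>
    have h := mul_integral_log (n + 1) hγ hR
    rw [expIntegralSum, Finset.sum_Icc_succ_top (by omega), mul_add, ← expIntegralSum, ← ih,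
      pow_succ, mul_div_right_comm, mul_assoc, h, Nat.factorial_succ, Nat.add_sub_cancel]
    generalize ∫ v in Set.Ioi (0 : ℝ), v ^ n * Real.exp (-(R * v)) * Real.log (1 + γ * v) = J
    push_cast
    field_simp

theorem measurable_gammaPDF (a r : ℝ) : Measurable (gammaPDF a r) :=
  (measurable_gammaPDFReal a r).ennreal_ofReal

theorem integral_gammaMeasure {E : Type*} [NormedAddCommGroup E] [NormedSpace ℝ E] (n : ℕ) {R : ℝ}
    (hR : 0 < R) (f : ℝ → E) : ∫ v, f v ∂(gammaMeasure (n + 1) R) =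
      ∫ v in Set.Ioi (0 : ℝ), (R ^ (n + 1) / n.factorial * (v ^ n * Real.exp (-(R * v)))) • f v := by
  rw [gammaMeasure, integral_withDensity_eq_integral_toReal_smul
    (measurable_gammaPDF _ _) (by simp [gammaPDF])]
  rw [← integral_Ici_eq_integral_Ioi, ← integral_indicator measurableSet_Ici]
  congr 1
  ext v
  by_cases hv : 0 ≤ v
  · rw [Set.indicator_of_mem (show v ∈ Set.Ici (0 : ℝ) from hv), gammaPDF_of_nonneg hv,
      ENNReal.toReal_ofReal (by have := Real.Gamma_pos_of_pos (show (0:ℝ) < n + 1 by positivity)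
                                positivity), add_sub_cancel_right, Real.rpow_natCast,
      Real.Gamma_nat_eq_factorial, ← Nat.cast_add_one, Real.rpow_natCast, mul_assoc]
  · rw [Set.indicator_of_notMem (show v ∉ Set.Ici (0 : ℝ) from hv), gammaPDF_of_neg (not_le.1 hv)]
    simp

theorem integrable_gammaMeasure_of {E : Type*} [NormedAddCommGroup E] [NormedSpace ℝ E] (n : ℕ)
    {R : ℝ} (hR : 0 < R) {f : ℝ → E}
    (hf : IntegrableOn (fun v => (v ^ n * Real.exp (-(R * v))) • f v) (Set.Ioi 0)) :
    Integrable f (gammaMeasure (n + 1) R) := by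
  rw [gammaMeasure, integrable_withDensity_iff_integrable_smul'
    (measurable_gammaPDF _ _) (by simp [gammaPDF])]
  have h1 : IntegrableOn (fun v => (R ^ (n + 1) / n.factorial : ℝ) •
    ((v ^ n * Real.exp (-(R * v))) • f v)) (Set.Ici 0) :=
    ((integrableOn_Ici_iff_integrableOn_Ioi (by finiteness)).2 hf).smul _
  refine ((integrable_indicator_iff measurableSet_Ici).2 h1).congr ?_
  filter_upwards with v
  by_cases hv : 0 ≤ v
  · rw [Set.indicator_of_mem (show v ∈ Set.Ici (0 : ℝ) from hv), gammaPDF_of_nonneg hv,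
      ENNReal.toReal_ofReal (by have := Real.Gamma_pos_of_pos (show (0:ℝ) < n + 1 by positivity)
                                positivity), add_sub_cancel_right, Real.rpow_natCast,
      Real.Gamma_nat_eq_factorial, ← Nat.cast_add_one, Real.rpow_natCast, mul_assoc]
    simp only [mul_smul]
  · rw [Set.indicator_of_notMem (show v ∉ Set.Ici (0 : ℝ) from hv), gammaPDF_of_neg (not_le.1 hv)]
    simp

theorem integral_log_gammaMeasure (n : ℕ) {γ R : ℝ} (hγ : 0 < γ) (hR : 0 < R) :
    ∫ v, Real.log (1 + γ * v) ∂(gammaMeasure (n + 1) R) =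
      Real.exp (R / γ) * expIntegralSum (n + 1) (R / γ) := by
  rw [integral_gammaMeasure n hR, ← integral_log_gamma n hγ hR, ← integral_const_mul]
  simp only [smul_eq_mul, mul_assoc]

theorem integrable_log_pow_gammaMeasure (n k : ℕ) {γ R : ℝ} (hγ : 0 < γ) (hR : 0 < R) :
    Integrable (fun v => Real.log (1 + γ * v) ^ k) (gammaMeasure (n + 1) R) :=
  integrable_gammaMeasure_of n hR (integrableOn_pow_mul_exp_neg_mul_log n k hγ hR)

/-- Substituting `u = 1 + γv` gives `e^{-v} = e^{1/γ} e^{-u/γ}` with Jacobian `γ`; the `2` undoes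
the `1/2` in `logSqLaplace`. -/
theorem integral_log_sq_exponential {γ : ℝ} (hγ : 0 < γ) :
    ∫ v, Real.log (1 + γ * v) ^ 2 ∂(gammaMeasure 1 1) =
      2 * Real.exp (1 / γ) / γ * logSqLaplace (1 / γ) := by
  have h := integral_gammaMeasure 0 one_pos (fun v => Real.log (1 + γ * v) ^ 2)
  simp only [CharP.cast_eq_zero, zero_add, one_pow, Nat.factorial_zero, Nat.cast_one, div_one,
    pow_zero, one_mul, smul_eq_mul] at h
  have himg : (fun v : ℝ => 1 + γ * v) '' Set.Ioi 0 = Set.Ioi 1 := by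
    ext u
    constructor
    · rintro ⟨v, hv, rfl⟩
      have hv : 0 < v := hv
      simp only [Set.mem_Ioi, lt_add_iff_pos_right]
      positivity
    · intro hu
      exact ⟨(u - 1) / γ, div_pos (sub_pos.2 hu) hγ, by field_simp; ring⟩
  have hd : ∀ v ∈ Set.Ioi (0 : ℝ), HasDerivWithinAt (fun v : ℝ => 1 + γ * v) γ (Set.Ioi 0) v :=
    fun v _ => by
      simpa using (((hasDerivAt_id v).const_mul γ).const_add 1).hasDerivWithinAt
  have hinj : Set.InjOn (fun v : ℝ => 1 + γ * v) (Set.Ioi 0) := fun a _ b _ hab => by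
    simpa [hγ.ne'] using hab
  rw [h, logSqLaplace, ← himg, integral_image_eq_integral_abs_deriv_smul measurableSet_Ioi hd hinj,
    ← integral_const_mul, ← integral_const_mul]
  refine setIntegral_congr_fun measurableSet_Ioi fun v _ => ?_
  simp only [smul_eq_mul, abs_of_pos hγ]
  have : -(1 / γ * (1 + γ * v)) = -(1 / γ) + -v := by field_simp; ring
  rw [this, Real.exp_add, Real.exp_neg (1 / γ)]
  field_simp

/-! ### The standard complex Gaussian law -/

instance : IsProbabilityMeasure stdComplexGaussian :=
  Measure.isProbabilityMeasure_map (by fun_prop)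

theorem integral_stdComplexGaussian {E : Type*} [NormedAddCommGroup E] [NormedSpace ℝ E]
    (f : ℂ → E) : ∫ z, f z ∂stdComplexGaussian =
      ∫ p : ℝ × ℝ, f (p.1 + p.2 * Complex.I)
        ∂((gaussianReal 0 (1 / 2)).prod (gaussianReal 0 (1 / 2))) := by
  rw [stdComplexGaussian, integral_map_equiv]
  congr 1
  ext p
  congr 1
  apply Complex.ext <;> simp [Complex.measurableEquivRealProd]

theorem integral_cexp_re_mul_stdComplexGaussian (α : ℂ) :
    ∫ z, Complex.exp ((α * z).re * Complex.I) ∂stdComplexGaussian =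
      Complex.exp (-(‖α‖ ^ 2 / 4 : ℝ)) := by
  rw [integral_stdComplexGaussian]
  have h : ∀ p : ℝ × ℝ, Complex.exp ((α * (p.1 + p.2 * Complex.I)).re * Complex.I) =
      Complex.exp (α.re * p.1 * Complex.I) * Complex.exp ((-α.im : ℝ) * p.2 * Complex.I) := by
    intro p
    rw [← Complex.exp_add]
    congr 1
    simp
    ring
  simp_rw [h]
  rw [integral_prod_mul (fun x : ℝ => Complex.exp (α.re * x * Complex.I))
    (fun y : ℝ => Complex.exp ((-α.im : ℝ) * y * Complex.I)), ← charFun_apply_real,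
    ← charFun_apply_real, charFun_gaussianReal, charFun_gaussianReal, ← Complex.exp_add,
    ← Complex.normSq_eq_norm_sq, Complex.normSq_apply]
  congr 1
  push_cast
  ring

theorem integral_cexp_mul_sq_gaussianReal {w : ℂ} (hw : w.re ≤ 0) (m c : ℝ) :
    ∫ x : ℝ, Complex.exp (w * (m + c * x) ^ 2) ∂(gaussianReal 0 (1 / 2)) =
      (((√Real.pi : ℝ) : ℂ)⁻¹ * (Real.pi / (1 - w * c ^ 2)) ^ (1 / 2 : ℂ)) *
        Complex.exp (w * m ^ 2 / (1 - w * c ^ 2)) := by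
  have hre : (-(1 - w * (c : ℂ) ^ 2)).re < 0 := by
    have : (w * (c : ℂ) ^ 2).re = w.re * c ^ 2 := by
      rw [← Complex.ofReal_pow, Complex.re_mul_ofReal]
    simp only [Complex.neg_re, Complex.sub_re, Complex.one_re, this]
    nlinarith [sq_nonneg c]
  have hne : 1 - w * (c : ℂ) ^ 2 ≠ 0 := fun h => by simp [h] at hre
  rw [integral_gaussianReal_eq_integral_smul (by norm_num)]
  have h : ∀ x : ℝ, gaussianPDFReal 0 (1 / 2) x • Complex.exp (w * (m + c * x) ^ 2) =
      ((√Real.pi : ℝ) : ℂ)⁻¹ * Complex.exp (-(1 - w * c ^ 2) * x ^ 2 + (2 * w * m * c) * x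
        + w * m ^ 2) := by
    intro x
    have hpi : 2 * Real.pi * ((1 / 2 : NNReal) : ℝ) = Real.pi := by
      push_cast
      ring
    rw [gaussianPDFReal, Complex.real_smul, hpi]
    push_cast
    rw [mul_assoc, ← Complex.exp_add]
    congr 2
    norm_num
    ring
  simp_rw [h]
  rw [integral_const_mul, integral_cexp_quadratic hre, neg_neg]
  have h2 : w * m ^ 2 - (2 * w * m * c) ^ 2 / (4 * -(1 - w * c ^ 2)) =
      w * m ^ 2 / (1 - w * c ^ 2) := by
    field_simp
    ring
  rw [h2, mul_assoc]

/-- The real and imaginary parts separate, and each is a one-dimensional Gaussian integral. Complex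
`w`, and not only imaginary `w`, is needed because integrating out one coordinate of a correlated
pair leaves such an exponent for the other. -/
theorem integral_cexp_mul_norm_sq_stdComplexGaussian {w : ℂ} (hw : w.re ≤ 0) (m : ℂ) (c : ℝ) :
    ∫ z, Complex.exp (w * (‖m + c * z‖ ^ 2 : ℝ)) ∂stdComplexGaussian =
      (1 - w * c ^ 2)⁻¹ * Complex.exp (w * (‖m‖ ^ 2 : ℝ) / (1 - w * c ^ 2)) := by
  rw [integral_stdComplexGaussian]
  have h : ∀ p : ℝ × ℝ, Complex.exp (w * (‖m + c * (p.1 + p.2 * Complex.I)‖ ^ 2 : ℝ)) =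
      Complex.exp (w * (m.re + c * p.1) ^ 2) * Complex.exp (w * (m.im + c * p.2) ^ 2) := by
    intro p
    rw [← Complex.exp_add, ← Complex.normSq_eq_norm_sq, Complex.normSq_apply]
    congr 1
    simp
    ring
  simp_rw [h]
  rw [integral_prod_mul (fun x : ℝ => Complex.exp (w * (m.re + c * x) ^ 2))
    (fun x : ℝ => Complex.exp (w * (m.im + c * x) ^ 2)),
    integral_cexp_mul_sq_gaussianReal hw, integral_cexp_mul_sq_gaussianReal hw,
    mul_mul_mul_comm, ← Complex.exp_add, ← Complex.normSq_eq_norm_sq, Complex.normSq_apply]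
  -- The two coordinates contribute the same principal square root, so the product has no branch
  -- ambiguity.
  have h2 : ∀ x : ℂ, x ^ (1 / 2 : ℂ) * x ^ (1 / 2 : ℂ) = x := fun x => by
    rw [← sq, one_div, Complex.cpow_ofNat_inv_pow]
  rw [mul_mul_mul_comm, h2]
  have h3 : ((√Real.pi : ℝ) : ℂ)⁻¹ * ((√Real.pi : ℝ) : ℂ)⁻¹ = (Real.pi : ℂ)⁻¹ := by
    rw [← mul_inv, ← Complex.ofReal_mul, Real.mul_self_sqrt Real.pi_pos.le]
  have hpi : (Real.pi : ℂ) ≠ 0 := by exact_mod_cast Real.pi_pos.ne'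
  rw [h3]
  congr 1
  · field_simp
  · congr 1
    push_cast
    ring

theorem integral_stdComplexGaussian_id : ∫ z, z ∂stdComplexGaussian = 0 := by
  rw [integral_stdComplexGaussian]
  have hi : Integrable (fun x : ℝ => (x : ℂ)) (gaussianReal 0 (1 / 2)) :=
    ((memLp_id_gaussianReal 1).integrable le_rfl).ofReal
  have h0 : ∫ x : ℝ, (x : ℂ) ∂(gaussianReal 0 (1 / 2)) = 0 := by
    rw [integral_complex_ofReal, integral_id_gaussianReal, Complex.ofReal_zero]
  rw [integral_add (hi.comp_fst _) ((hi.comp_snd _).mul_const _),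
    integral_mul_const, integral_fun_fst (fun x : ℝ => (x : ℂ)),
    integral_fun_snd (fun x : ℝ => (x : ℂ)), h0]
  simp

theorem integral_cexp_gammaMeasure (n : ℕ) {R : ℝ} (hR : 0 < R) (s : ℝ) :
    ∫ v, Complex.exp (s * v * Complex.I) ∂(gammaMeasure (n + 1) R) =
      (1 - s * Complex.I / R)⁻¹ ^ (n + 1) := by
  have hw : 0 < ((R : ℂ) - s * Complex.I).re := by simpa using hR
  have hR0 : (R : ℂ) ≠ 0 := by exact_mod_cast hR.ne'
  have hw0 : (R : ℂ) - s * Complex.I ≠ 0 := fun h => by simp [h] at hw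
  have hf : (n.factorial : ℂ) ≠ 0 := by exact_mod_cast n.factorial_ne_zero
  have h : ∀ v : ℝ, (R ^ (n + 1) / n.factorial * (v ^ n * Real.exp (-(R * v)))) •
      Complex.exp (s * v * Complex.I) = ((R : ℂ) ^ (n + 1) / n.factorial) *
        ((v : ℂ) ^ n * Complex.exp (-((R - s * Complex.I) * v))) := by
    intro v
    rw [Complex.real_smul]
    push_cast
    rw [mul_assoc, mul_assoc, ← Complex.exp_add]
    ring_nf
  have h1 : 1 - s * Complex.I / R = (R - s * Complex.I) / R := by field_simp
  rw [integral_gammaMeasure n hR]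
  simp_rw [h]
  rw [integral_const_mul, integral_pow_mul_cexp_neg n hw, h1, inv_div, div_pow]
  field_simp

instance (n : ℕ) (R : ℝ) [hR : Fact (0 < R)] : IsProbabilityMeasure (gammaMeasure (n + 1) R) :=
  isProbabilityMeasure_gammaMeasure (by positivity) hR.out

theorem map_norm_sq_stdComplexGaussian :
    stdComplexGaussian.map (fun z => ‖z‖ ^ 2) = gammaMeasure 1 1 := by
  have h1 := isProbabilityMeasure_gammaMeasure one_pos one_pos
  have h2 : IsProbabilityMeasure (stdComplexGaussian.map (fun z => ‖z‖ ^ 2)) :=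
    Measure.isProbabilityMeasure_map (by fun_prop)
  refine Measure.ext_of_charFun (funext fun s => ?_)
  have h3 := integral_cexp_gammaMeasure 0 one_pos s
  have h4 := integral_cexp_mul_norm_sq_stdComplexGaussian (w := s * Complex.I) (by simp) 0 1
  rw [charFun_apply_real, charFun_apply_real, integral_map (by fun_prop) (by fun_prop)]
  simp only [Nat.cast_zero, zero_add, pow_one, Complex.ofReal_one, div_one, one_mul, one_pow,
    mul_one, norm_zero, ne_eq, OfNat.ofNat_ne_zero, not_false_eq_true, zero_pow,
    Complex.ofReal_zero, mul_zero, zero_div, Complex.exp_zero] at h3 h4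
  rw [h3, ← h4]
  congr 1
  ext z
  ring_nf

/-! ### Correlated pairs -/

/-- From two independent standard complex Gaussians, a pair with correlation coefficient `ρ`. -/
noncomputable def correlatedPair (ρ : ℂ) (z : ℂ × ℂ) : ℂ × ℂ :=
  (z.1, (starRingEnd ℂ) ρ * z.1 + (√(1 - ‖ρ‖ ^ 2) : ℝ) * z.2)

@[fun_prop]
theorem measurable_correlatedPair (ρ : ℂ) : Measurable (correlatedPair ρ) := by
  unfold correlatedPair
  fun_prop

theorem strongDual_prod_complex (L : StrongDual ℝ (ℂ × ℂ)) :
    ∃ u v : ℂ, ∀ z, L z = (u * z.1).re + (v * z.2).re := by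
  refine ⟨⟨L (1, 0), -L (Complex.I, 0)⟩, ⟨L (0, 1), -L (0, Complex.I)⟩, fun z => ?_⟩
  have h : z = z.1.re • ((1 : ℂ), (0 : ℂ)) + z.1.im • (Complex.I, (0 : ℂ)) +
      (z.2.re • ((0 : ℂ), (1 : ℂ)) + z.2.im • ((0 : ℂ), Complex.I)) := by
    ext <;> simp
  conv_lhs => rw [h]
  simp only [map_add, map_smul, smul_eq_mul, Complex.mul_re]
  ring

theorem norm_sq_add (x y : ℂ) :
    ‖x + y‖ ^ 2 = ‖x‖ ^ 2 + ‖y‖ ^ 2 + 2 * (x * (starRingEnd ℂ) y).re := by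
  simp_rw [← Complex.normSq_eq_norm_sq, Complex.normSq_add]

theorem integrable_cexp_ofReal_mul_I {α : Type*} [MeasurableSpace α] {μ : Measure α}
    [IsFiniteMeasure μ] {f : α → ℝ} (hf : Measurable f) :
    Integrable (fun x => Complex.exp (f x * Complex.I)) μ := by
  refine Integrable.of_bound (C := 1) (by fun_prop) (Filter.Eventually.of_forall fun x => ?_)
  rw [Complex.norm_exp_ofReal_mul_I]

theorem integral_cexp_correlatedPair {ρ : ℂ} (hρ : ‖ρ‖ ≤ 1) (u v : ℂ) :
    ∫ z, Complex.exp (((u * (correlatedPair ρ z).1).re + (v * (correlatedPair ρ z).2).re : ℝ) *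
      Complex.I) ∂(stdComplexGaussian.prod stdComplexGaussian) =
      Complex.exp (-((‖u‖ ^ 2 + ‖v‖ ^ 2 + 2 * (u * (starRingEnd ℂ) v * ρ).re) / 4 : ℝ)) := by
  have h0 : 0 ≤ 1 - ‖ρ‖ ^ 2 := by nlinarith [norm_nonneg ρ]
  have h : ∀ z : ℂ × ℂ, Complex.exp (((u * (correlatedPair ρ z).1).re +
      (v * (correlatedPair ρ z).2).re : ℝ) * Complex.I) =
      Complex.exp (((u + v * (starRingEnd ℂ) ρ) * z.1).re * Complex.I) *
        Complex.exp ((v * (√(1 - ‖ρ‖ ^ 2) : ℝ) * z.2).re * Complex.I) := by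
    intro z
    rw [← Complex.exp_add, ← add_mul, ← Complex.ofReal_add, ← Complex.add_re, ← Complex.add_re,
      correlatedPair]
    ring_nf
  simp_rw [h]
  rw [integral_prod_mul (fun z : ℂ => Complex.exp (((u + v * (starRingEnd ℂ) ρ) * z).re *
      Complex.I)) (fun z : ℂ => Complex.exp ((v * (√(1 - ‖ρ‖ ^ 2) : ℝ) * z).re * Complex.I)),
    integral_cexp_re_mul_stdComplexGaussian, integral_cexp_re_mul_stdComplexGaussian,
    ← Complex.exp_add, norm_sq_add, norm_mul, norm_mul, Complex.norm_real, RCLike.norm_conj,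
    Real.norm_of_nonneg (Real.sqrt_nonneg _), mul_pow, mul_pow, Real.sq_sqrt h0, map_mul,
    Complex.conj_conj, ← mul_assoc]
  congr 1
  push_cast
  ring

/-- By independence the characteristic function is a product of Gaussian factors whose quadratic
exponents add up. By circular symmetry only `∑|a|²`, `∑|b|²` and `∑ a b̄` enter the result. -/
theorem map_pair_eq {Ω ι : Type*} [Fintype ι] [MeasurableSpace Ω] {P : Measure Ω}
    [IsProbabilityMeasure P] {Z : ι → Ω → ℂ} (hZ : ∀ p, HasLaw (Z p) stdComplexGaussian P)
    (hind : iIndepFun Z P) {a b : ι → ℂ} (ha : ∑ p, ‖a p‖ ^ 2 = 1) (hb : ∑ p, ‖b p‖ ^ 2 = 1)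
    {ρ : ℂ} (hρ : ‖ρ‖ ≤ 1) (hab : ∑ p, a p * (starRingEnd ℂ) (b p) = ρ) :
    P.map (fun ω => (∑ p, a p * Z p ω, ∑ p, b p * Z p ω)) =
      (stdComplexGaussian.prod stdComplexGaussian).map (correlatedPair ρ) := by
  have hm : ∀ p, AEMeasurable (Z p) P := fun p => (hZ p).aemeasurable
  have hmp : AEMeasurable (fun ω => (∑ p, a p * Z p ω, ∑ p, b p * Z p ω)) P := by fun_prop
  have h1 := Measure.isProbabilityMeasure_map hmp
  have h2 := Measure.isProbabilityMeasure_map (μ := stdComplexGaussian.prod stdComplexGaussian)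
    (measurable_correlatedPair ρ).aemeasurable
  refine Measure.ext_of_charFunDual (funext fun L => ?_)
  obtain ⟨u, v, hL⟩ := strongDual_prod_complex L
  rw [charFunDual_apply, charFunDual_apply, integral_map hmp (by fun_prop),
    integral_map (by fun_prop) (by fun_prop)]
  simp_rw [hL]
  rw [integral_cexp_correlatedPair hρ]
  have h3 : ∀ ω, Complex.exp (((u * ∑ p, a p * Z p ω).re + (v * ∑ p, b p * Z p ω).re : ℝ) *
      Complex.I) = ∏ p, Complex.exp ((((u * a p + v * b p) * Z p ω).re : ℝ) * Complex.I) := by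
    intro ω
    rw [← Complex.exp_sum, ← Finset.sum_mul, ← Complex.ofReal_sum, ← Complex.re_sum,
      ← Complex.add_re, Finset.mul_sum, Finset.mul_sum, ← Finset.sum_add_distrib]
    congr 4
    refine Finset.sum_congr rfl fun p _ => ?_
    ring
  simp_rw [h3]
  rw [hind.integral_fun_prod_comp (f := fun p z =>
    Complex.exp ((((u * a p + v * b p) * z).re : ℝ) * Complex.I)) hm (fun p => by fun_prop)]
  have h4 : ∀ p, ∫ ω, Complex.exp ((((u * a p + v * b p) * Z p ω).re : ℝ) * Complex.I) ∂P =
      Complex.exp (-(‖u * a p + v * b p‖ ^ 2 / 4 : ℝ)) := fun p => by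
    rw [← integral_cexp_re_mul_stdComplexGaussian, ← (hZ p).map_eq,
      integral_map (hm p) (by fun_prop)]
  simp_rw [h4]
  rw [← Complex.exp_sum]
  congr 1
  rw [Finset.sum_neg_distrib, ← Complex.ofReal_sum, ← Finset.sum_div]
  congr 3
  have h5 : ∀ p, ‖u * a p + v * b p‖ ^ 2 = ‖u‖ ^ 2 * ‖a p‖ ^ 2 + ‖v‖ ^ 2 * ‖b p‖ ^ 2 +
      2 * ((u * (starRingEnd ℂ) v) * (a p * (starRingEnd ℂ) (b p))).re := fun p => by
    rw [norm_sq_add, norm_mul, norm_mul, mul_pow, mul_pow, map_mul]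
    ring_nf
  simp_rw [h5]
  rw [Finset.sum_add_distrib, Finset.sum_add_distrib, ← Finset.mul_sum, ← Finset.mul_sum,
    ← Finset.mul_sum, ← Complex.re_sum, ← Finset.mul_sum, ha, hb, hab]
  ring

/-! ### The joint law of the squared moduli -/

/-- The mixture, with weights `(1 - r²) r^{2t}`, of the laws of two independent Gamma variables of
shape `t + 1` and scale `1 - r²`. -/
noncomputable def gammaMixture (r : ℝ) : Measure (ℝ × ℝ) :=
  Measure.sum fun t : ℕ => ENNReal.ofReal ((1 - r ^ 2) * r ^ (2 * t)) •
    (gammaMeasure (t + 1) (1 / (1 - r ^ 2))).prod (gammaMeasure (t + 1) (1 / (1 - r ^ 2)))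

/-- Given the first coordinate, the second is Gaussian with shifted mean. Integrating it out leaves
an exponential of the first squared modulus, to which the same formula applies again. -/
theorem integral_cexp_norm_sq_correlatedPair {ρ : ℂ} (hρ : ‖ρ‖ < 1) (s u : ℝ) :
    ∫ z, Complex.exp ((s * ‖(correlatedPair ρ z).1‖ ^ 2 + u * ‖(correlatedPair ρ z).2‖ ^ 2 : ℝ) *
      Complex.I) ∂(stdComplexGaussian.prod stdComplexGaussian) =
      (1 - ‖ρ‖ ^ 2) * ((1 - s * Complex.I * (1 - ‖ρ‖ ^ 2)) * (1 - u * Complex.I * (1 - ‖ρ‖ ^ 2))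
        - ‖ρ‖ ^ 2)⁻¹ := by
  have h0 : 0 < 1 - ‖ρ‖ ^ 2 := by nlinarith [norm_nonneg ρ]
  set q := 1 - ‖ρ‖ ^ 2 with hq
  have hqc : (1 - (‖ρ‖ : ℂ) ^ 2) = (q : ℂ) := by rw [hq]; push_cast; ring
  have hc : ((√q : ℝ) : ℂ) ^ 2 = (q : ℂ) := by
    rw [← Complex.ofReal_pow, Real.sq_sqrt h0.le]
  have hne : ∀ x : ℝ, (1 : ℂ) - x * Complex.I ≠ 0 := fun x h => by
    have := congrArg Complex.re h
    simp at this
  have hne' : (1 : ℂ) - u * Complex.I * q ≠ 0 := by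
    have := hne (u * q)
    push_cast at this
    rwa [mul_right_comm] at this
  rw [integral_prod _ (integrable_cexp_ofReal_mul_I (by fun_prop))]
  set w : ℂ := s * Complex.I + u * Complex.I * (‖ρ‖ ^ 2 : ℝ) / (1 - u * Complex.I * q) with hw
  -- Multiplying through by the conjugate denominator shows that the real part of `w` is
  -- `-u²‖ρ‖²q/(1 + u²q²)`.
  have hwre : w.re ≤ 0 := by
    have h1 : w = s * Complex.I + u * Complex.I * (‖ρ‖ ^ 2 : ℝ) * (1 + u * Complex.I * q) *
        ((1 + u ^ 2 * q ^ 2)⁻¹ : ℝ) := by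
      have h2 : (1 : ℂ) + u ^ 2 * q ^ 2 = (1 - u * Complex.I * q) * (1 + u * Complex.I * q) := by
        ring_nf
        simp
      have h3 : (1 : ℂ) + u * Complex.I * q ≠ 0 := by
        have := hne (-(u * q))
        push_cast at this
        rwa [neg_mul, sub_neg_eq_add, mul_right_comm] at this
      rw [hw]
      push_cast
      rw [h2]
      generalize (1 : ℂ) - u * Complex.I * q = D at hne' ⊢
      generalize (1 : ℂ) + u * Complex.I * q = D' at h3 ⊢
      field_simp
    rw [h1, Complex.add_re, Complex.re_mul_ofReal]
    simp
    rw [← sub_nonneg]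
    have : 0 ≤ u * ‖ρ‖ ^ 2 * (u * q) * (1 + u ^ 2 * q ^ 2)⁻¹ := by
      have : u * ‖ρ‖ ^ 2 * (u * q) = u ^ 2 * ‖ρ‖ ^ 2 * q := by ring
      rw [this]
      positivity
    simp [← Complex.ofReal_pow]
    linarith
  have hin : ∀ x : ℂ, ∫ y, Complex.exp ((s * ‖(correlatedPair ρ (x, y)).1‖ ^ 2 +
      u * ‖(correlatedPair ρ (x, y)).2‖ ^ 2 : ℝ) * Complex.I) ∂stdComplexGaussian =
      (1 - u * Complex.I * q)⁻¹ * Complex.exp (w * (‖0 + (1 : ℝ) * x‖ ^ 2 : ℝ)) := by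
    intro x
    have h1 : ∀ y : ℂ, Complex.exp ((s * ‖(correlatedPair ρ (x, y)).1‖ ^ 2 +
      u * ‖(correlatedPair ρ (x, y)).2‖ ^ 2 : ℝ) * Complex.I) =
      Complex.exp (s * Complex.I * (‖x‖ ^ 2 : ℝ)) * Complex.exp ((u * Complex.I) *
        (‖(starRingEnd ℂ) ρ * x + (√q : ℝ) * y‖ ^ 2 : ℝ)) := by
      intro y
      rw [← Complex.exp_add, correlatedPair, ← hq]
      push_cast
      ring_nf
    simp_rw [h1]
    rw [integral_const_mul, integral_cexp_mul_norm_sq_stdComplexGaussian (by simp), hc,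
      mul_left_comm, ← Complex.exp_add, hw, norm_mul, RCLike.norm_conj]
    congr 2
    simp
    ring
  simp_rw [hin]
  rw [integral_const_mul, integral_cexp_mul_norm_sq_stdComplexGaussian hwre]
  simp only [Complex.ofReal_one, one_pow, mul_one, norm_zero, ne_eq, OfNat.ofNat_ne_zero,
    not_false_eq_true, zero_pow, Complex.ofReal_zero, mul_zero, zero_div, Complex.exp_zero]
  have hq0 : (q : ℂ) ≠ 0 := by exact_mod_cast h0.ne'
  have key : (1 - s * Complex.I * q) * (1 - u * Complex.I * q) - (‖ρ‖ : ℂ) ^ 2 =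
      q * ((1 - u * Complex.I * q) * (1 - w)) := by
    have hw' : (1 - u * Complex.I * q) * w = (1 - u * Complex.I * q) * (s * Complex.I) +
        u * Complex.I * ‖ρ‖ ^ 2 := by
      rw [hw, mul_add, mul_div_cancel₀ _ hne', Complex.ofReal_pow]
    linear_combination q * hw' + (1 - u * Complex.I * q) * hqc
  rw [hqc, key, mul_inv, ← mul_assoc, mul_inv_cancel₀ hq0, one_mul, mul_inv]

theorem one_sub_sq_pos {r : ℝ} (h0 : 0 ≤ r) (h1 : r < 1) : 0 < 1 - r ^ 2 := by nlinarith

theorem hasSum_gammaMixture_weights {r : ℝ} (h0 : 0 ≤ r) (h1 : r < 1) :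
    HasSum (fun t : ℕ => (1 - r ^ 2) * r ^ (2 * t)) 1 := by
  have hq := one_sub_sq_pos h0 h1
  have h := (hasSum_geometric_of_lt_one (sq_nonneg r) (by linarith)).mul_left (1 - r ^ 2)
  rw [mul_inv_cancel₀ hq.ne'] at h
  simpa only [pow_mul] using h

theorem isProbabilityMeasure_gammaMixture {r : ℝ} (h0 : 0 ≤ r) (h1 : r < 1) :
    IsProbabilityMeasure (gammaMixture r) := by
  have hq := one_sub_sq_pos h0 h1
  have hR : Fact (0 < 1 / (1 - r ^ 2)) := ⟨by positivity⟩
  constructor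
  have h := hasSum_gammaMixture_weights h0 h1
  rw [gammaMixture, Measure.sum_apply _ MeasurableSet.univ]
  simp only [Measure.smul_apply, measure_univ, smul_eq_mul, mul_one]
  rw [← ENNReal.ofReal_tsum_of_nonneg (fun t => by positivity) h.summable, h.tsum_eq,
    ENNReal.ofReal_one]

theorem hasSum_integral_gammaMixture {r : ℝ} (h0 : 0 ≤ r) (h1 : r < 1) {𝕜 : Type*} [RCLike 𝕜]
    {f g : ℝ → 𝕜} (h : Integrable (fun z : ℝ × ℝ => f z.1 * g z.2) (gammaMixture r)) :
    HasSum (fun t : ℕ => (((1 - r ^ 2) * r ^ (2 * t) : ℝ) : 𝕜) *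
      ((∫ v, f v ∂(gammaMeasure (t + 1) (1 / (1 - r ^ 2)))) *
        ∫ v, g v ∂(gammaMeasure (t + 1) (1 / (1 - r ^ 2)))))
      (∫ z, f z.1 * g z.2 ∂(gammaMixture r)) := by
  have hq := one_sub_sq_pos h0 h1
  have hR : Fact (0 < 1 / (1 - r ^ 2)) := ⟨by positivity⟩
  refine (hasSum_integral_measure h).congr_fun ?_
  intro t
  rw [integral_smul_measure, integral_prod_mul, ENNReal.toReal_ofReal (by positivity),
    RCLike.real_smul_eq_coe_mul]

theorem norm_inv_one_sub_mul_I_le (x : ℝ) : ‖((1 : ℂ) - x * Complex.I)⁻¹‖ ≤ 1 := by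
  rw [norm_inv]
  refine inv_le_one_of_one_le₀ ?_
  have := Complex.abs_re_le_norm ((1 : ℂ) - x * Complex.I)
  simpa using this

/-- The component of index `t` has characteristic function `(p p')^{t+1}`, so the mixture is a
geometric series of ratio `r² p p'`, whose modulus is below `1` because `‖p‖, ‖p'‖ ≤ 1` and `r < 1`.
-/
theorem integral_cexp_gammaMixture {r : ℝ} (h0 : 0 ≤ r) (h1 : r < 1) (s u : ℝ) :
    ∫ z, Complex.exp ((s * z.1 + u * z.2 : ℝ) * Complex.I) ∂(gammaMixture r) =
      (1 - r ^ 2) * ((1 - s * Complex.I * (1 - r ^ 2)) * (1 - u * Complex.I * (1 - r ^ 2))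
        - r ^ 2)⁻¹ := by
  have hq := one_sub_sq_pos h0 h1
  have hprob := isProbabilityMeasure_gammaMixture h0 h1
  have hR : 0 < 1 / (1 - r ^ 2) := by positivity
  have hf : ∀ z : ℝ × ℝ, Complex.exp ((s * z.1 + u * z.2 : ℝ) * Complex.I) =
      Complex.exp (s * z.1 * Complex.I) * Complex.exp (u * z.2 * Complex.I) := fun z => by
    rw [← Complex.exp_add]
    push_cast
    ring_nf
  have hint := integrable_cexp_ofReal_mul_I (μ := gammaMixture r)
    (f := fun z => s * z.1 + u * z.2) (by fun_prop)
  simp_rw [hf] at hint ⊢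
  have h := hasSum_integral_gammaMixture h0 h1 (f := fun x : ℝ => Complex.exp (s * x * Complex.I))
    (g := fun x : ℝ => Complex.exp (u * x * Complex.I)) hint
  have hc : ∀ x : ℝ, (1 : ℂ) - x * Complex.I / (1 / (1 - r ^ 2) : ℝ) =
      1 - (x * (1 - r ^ 2) : ℝ) * Complex.I := fun x => by
    push_cast
    rw [div_div_eq_mul_div, div_one]
    ring
  simp_rw [integral_cexp_gammaMeasure _ hR, hc] at h
  set p := ((1 : ℂ) - (s * (1 - r ^ 2) : ℝ) * Complex.I)⁻¹ with hp
  set p' := ((1 : ℂ) - (u * (1 - r ^ 2) : ℝ) * Complex.I)⁻¹ with hp'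
  have hlt : ‖(r : ℂ) ^ 2 * (p * p')‖ < 1 := by
    have h2 := norm_inv_one_sub_mul_I_le (s * (1 - r ^ 2))
    have h3 := norm_inv_one_sub_mul_I_le (u * (1 - r ^ 2))
    rw [norm_mul, norm_mul, norm_pow, Complex.norm_real, Real.norm_eq_abs, sq_abs]
    have h4 : ‖p‖ * ‖p'‖ ≤ 1 := mul_le_one₀ h2 (norm_nonneg _) h3
    nlinarith [sq_nonneg r]
  have hg := ((hasSum_geometric_of_norm_lt_one hlt).mul_left ((1 - r ^ 2 : ℂ) * (p * p')))
  have hne : ∀ x : ℝ, (1 : ℂ) - x * Complex.I ≠ 0 := fun x h => by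
    have := congrArg Complex.re h
    simp at this
  have hp0 : p ≠ 0 := inv_ne_zero (hne _)
  have hp0' : p' ≠ 0 := inv_ne_zero (hne _)
  refine h.unique (HasSum.congr_fun ?_ (fun t => ?_) (f := fun t =>
    (1 - r ^ 2 : ℂ) * (p * p') * ((r : ℂ) ^ 2 * (p * p')) ^ t))
  · have h5 : (1 - s * Complex.I * (1 - r ^ 2)) = p⁻¹ := by
      rw [hp, inv_inv]; push_cast; ring
    have h6 : (1 - u * Complex.I * (1 - r ^ 2)) = p'⁻¹ := by
      rw [hp', inv_inv]; push_cast; ring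
    have h7 : p⁻¹ * p'⁻¹ - (r : ℂ) ^ 2 = (p * p')⁻¹ * (1 - (r : ℂ) ^ 2 * (p * p')) := by
      field_simp
    rw [h5, h6, h7, mul_inv, inv_inv]
    simpa only [mul_assoc] using hg
  · simp only [Complex.coe_algebraMap, RCLike.ofReal_mul]
    push_cast
    ring

/-- Comparing joint characteristic functions avoids the Bessel-type density of the two moduli. -/
theorem map_norm_sq_correlatedPair {ρ : ℂ} (hρ : ‖ρ‖ < 1) :
    (stdComplexGaussian.prod stdComplexGaussian).map
      (fun z => (‖(correlatedPair ρ z).1‖ ^ 2, ‖(correlatedPair ρ z).2‖ ^ 2)) =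
      gammaMixture ‖ρ‖ := by
  have h1 := isProbabilityMeasure_gammaMixture (norm_nonneg ρ) hρ
  have hm : Measurable fun z =>
    (‖(correlatedPair ρ z).1‖ ^ 2, ‖(correlatedPair ρ z).2‖ ^ 2) := by fun_prop
  have h2 := Measure.isProbabilityMeasure_map (μ := stdComplexGaussian.prod stdComplexGaussian)
    hm.aemeasurable
  refine Measure.ext_of_charFunDual (funext fun L => ?_)
  obtain ⟨s, u, hL⟩ : ∃ s u : ℝ, ∀ z : ℝ × ℝ, L z = s * z.1 + u * z.2 := by
    refine ⟨L (1, 0), L (0, 1), fun z => ?_⟩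
    have h : z = z.1 • ((1 : ℝ), (0 : ℝ)) + z.2 • ((0 : ℝ), (1 : ℝ)) := by ext <;> simp
    conv_lhs => rw [h]
    simp only [map_add, map_smul, smul_eq_mul]
    ring
  rw [charFunDual_apply, charFunDual_apply, integral_map hm.aemeasurable (by fun_prop)]
  simp_rw [hL]
  rw [integral_cexp_gammaMixture (norm_nonneg ρ) hρ, integral_cexp_norm_sq_correlatedPair hρ]

/-! ### Log-moments of a unit pair of correlated complex Gaussians -/

section Pair

variable {Ω : Type*} [MeasurableSpace Ω] {P : Measure Ω} {X Y : Ω → ℂ} {ρ : ℂ} {γ : ℝ}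

/-- `(X, Y)` has the law of the correlated pair with coefficient `ρ`. -/
def IsCorrelatedPair (P : Measure Ω) (X Y : Ω → ℂ) (ρ : ℂ) : Prop :=
  HasLaw (fun ω => (X ω, Y ω))
    ((stdComplexGaussian.prod stdComplexGaussian).map (correlatedPair ρ)) P

theorem IsCorrelatedPair.integral_comp {E : Type*} [NormedAddCommGroup E] [NormedSpace ℝ E]
    (h : IsCorrelatedPair P X Y ρ) {f : ℂ × ℂ → E} (hf : StronglyMeasurable f) :
    ∫ ω, f (X ω, Y ω) ∂P =
      ∫ z, f (correlatedPair ρ z) ∂(stdComplexGaussian.prod stdComplexGaussian) := by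
  rw [← integral_map h.aemeasurable hf.aestronglyMeasurable, h.map_eq,
    integral_map (by fun_prop) hf.aestronglyMeasurable]

theorem IsCorrelatedPair.hasLaw_left (h : IsCorrelatedPair P X Y ρ) :
    HasLaw X stdComplexGaussian P := by
  refine ⟨h.aemeasurable.fst, ?_⟩
  have h1 : P.map X = (P.map (fun ω => (X ω, Y ω))).map Prod.fst := by
    rw [AEMeasurable.map_map_of_aemeasurable (by fun_prop) h.aemeasurable]
    rfl
  rw [h1, h.map_eq, Measure.map_map measurable_fst (measurable_correlatedPair ρ)]
  exact Measure.map_fst_prod.trans (by simp)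

theorem hasLaw_norm_sq (h : HasLaw X stdComplexGaussian P) :
    HasLaw (fun ω => ‖X ω‖ ^ 2) (gammaMeasure 1 1) P := by
  have hm := h.aemeasurable
  refine ⟨by fun_prop, ?_⟩
  rw [← map_norm_sq_stdComplexGaussian, ← h.map_eq,
    AEMeasurable.map_map_of_aemeasurable (by fun_prop) hm]
  rfl

theorem integral_log_eq (hγ : 0 < γ) (h : HasLaw X stdComplexGaussian P) :
    ∫ ω, Real.log (1 + γ * ‖X ω‖ ^ 2) ∂P = Real.exp (1 / γ) * g₁ 1 γ 1 := by
  have h1 := integral_log_gammaMeasure 0 hγ one_pos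
  simp only [Nat.cast_zero, zero_add] at h1
  rw [g₁, Nat.cast_one, ← h1, ← (hasLaw_norm_sq h).map_eq,
    integral_map (hasLaw_norm_sq h).aemeasurable (Measurable.aestronglyMeasurable (by fun_prop))]

theorem integral_log_sq_eq (hγ : 0 < γ) (h : HasLaw X stdComplexGaussian P) :
    ∫ ω, Real.log (1 + γ * ‖X ω‖ ^ 2) ^ 2 ∂P =
      2 * Real.exp (1 / γ) / γ * logSqLaplace (1 / γ) := by
  rw [← integral_log_sq_exponential hγ, ← (hasLaw_norm_sq h).map_eq,
    integral_map (hasLaw_norm_sq h).aemeasurable (Measurable.aestronglyMeasurable (by fun_prop))]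

theorem memLp_log (hγ : 0 < γ) (h : HasLaw X stdComplexGaussian P) :
    MemLp (fun ω => Real.log (1 + γ * ‖X ω‖ ^ 2)) 2 P := by
  have hm := h.aemeasurable
  rw [memLp_two_iff_integrable_sq (by
    have : AEMeasurable (fun ω => Real.log (1 + γ * ‖X ω‖ ^ 2)) P := by fun_prop
    exact this.aestronglyMeasurable)]
  have h1 := integrable_log_pow_gammaMeasure 0 2 hγ one_pos
  simp only [Nat.cast_zero, zero_add] at h1
  rw [← (hasLaw_norm_sq h).map_eq] at h1
  exact h1.comp_aemeasurable (hasLaw_norm_sq h).aemeasurable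

theorem IsCorrelatedPair.integral_mul_conj (h : IsCorrelatedPair P X Y ρ) :
    ∫ ω, X ω * (starRingEnd ℂ) (Y ω) ∂P = ρ := by
  have hs : ∫ z, ‖z‖ ^ 2 ∂stdComplexGaussian = 1 := by
    have h1 := integral_gammaMeasure 0 one_pos (fun v => v)
    simp only [Nat.cast_zero, zero_add] at h1
    have h2 := integral_pow_mul_exp_neg 1 one_pos
    have h3 : ∫ z, ‖z‖ ^ 2 ∂stdComplexGaussian =
        ∫ v, v ∂(stdComplexGaussian.map (fun z => ‖z‖ ^ 2)) := by
      rw [integral_map (by fun_prop) (by fun_prop)]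
    rw [h3, map_norm_sq_stdComplexGaussian, h1]
    simpa [mul_comm] using h2
  have hi2 : Integrable (fun z => ‖z‖ ^ 2) stdComplexGaussian := by
    -- The integral equals `1`, so it cannot be the default value `0` of a non-integrable function.
    by_contra hn
    rw [integral_undef hn] at hs
    exact zero_ne_one hs
  have hi1 : Integrable (fun z : ℂ => z) stdComplexGaussian := by
    have : MemLp (fun z : ℂ => z) 2 stdComplexGaussian :=
      (memLp_two_iff_integrable_sq_norm (by fun_prop)).2 hi2
    exact this.integrable (by norm_num)
  have hi1' : Integrable (fun z : ℂ => (starRingEnd ℂ) z) stdComplexGaussian :=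
    hi1.norm.mono' (by fun_prop) (Filter.Eventually.of_forall fun z => by simp)
  rw [h.integral_comp (f := fun z => z.1 * (starRingEnd ℂ) z.2) (by fun_prop)]
  have he : ∀ z : ℂ × ℂ, (correlatedPair ρ z).1 * (starRingEnd ℂ) (correlatedPair ρ z).2 =
      ρ * ((‖z.1‖ ^ 2 : ℝ) : ℂ) + (√(1 - ‖ρ‖ ^ 2) : ℝ) * (z.1 * (starRingEnd ℂ) z.2) := by
    intro z
    simp only [correlatedPair, map_add, map_mul, Complex.conj_conj, Complex.conj_ofReal]
    rw [Complex.ofReal_pow, ← Complex.mul_conj']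
    ring
  simp_rw [he]
  have hi3 : Integrable (fun z : ℂ => ((‖z‖ ^ 2 : ℝ) : ℂ)) stdComplexGaussian := hi2.ofReal
  rw [integral_add ((hi3.comp_fst _).const_mul _) ((hi1.mul_prod hi1').const_mul _),
    integral_const_mul, integral_const_mul,
    integral_fun_fst (fun z : ℂ => ((‖z‖ ^ 2 : ℝ) : ℂ)), integral_complex_ofReal, hs,
    integral_prod_mul (fun z : ℂ => z) (fun z : ℂ => (starRingEnd ℂ) z),
    integral_stdComplexGaussian_id]
  simp

/-- Both logarithms are square-integrable, so their product is integrable and its integral splits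
over the mixture. Convergence of the series comes with this, without any estimate on `g₂`. -/
theorem IsCorrelatedPair.hasSum_integral_log_mul_log [IsProbabilityMeasure P]
    (h : IsCorrelatedPair P X Y ρ)
    (hY : HasLaw Y stdComplexGaussian P) (hγ : 0 < γ) (hρ : ‖ρ‖ < 1) :
    HasSum (fun t => (1 - ‖ρ‖ ^ 2) * Real.exp (2 / (γ * (1 - ‖ρ‖ ^ 2))) * sisoSeriesTerm γ ρ t)
      (∫ ω, Real.log (1 + γ * ‖X ω‖ ^ 2) * Real.log (1 + γ * ‖Y ω‖ ^ 2) ∂P) := by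
  have hq := one_sub_sq_pos (norm_nonneg ρ) hρ
  have hR : 0 < 1 / (1 - ‖ρ‖ ^ 2) := by positivity
  have hXY := h.aemeasurable
  have hm : Measurable fun z : ℂ × ℂ => (‖z.1‖ ^ 2, ‖z.2‖ ^ 2) := by fun_prop
  have hmap : P.map (fun ω => (‖X ω‖ ^ 2, ‖Y ω‖ ^ 2)) = gammaMixture ‖ρ‖ := by
    rw [← map_norm_sq_correlatedPair hρ]
    have h1 : P.map (fun ω => (‖X ω‖ ^ 2, ‖Y ω‖ ^ 2)) =
        (P.map (fun ω => (X ω, Y ω))).map (fun z : ℂ × ℂ => (‖z.1‖ ^ 2, ‖z.2‖ ^ 2)) := by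
      rw [AEMeasurable.map_map_of_aemeasurable hm.aemeasurable hXY]
      rfl
    rw [h1, h.map_eq, Measure.map_map hm (measurable_correlatedPair ρ)]
    rfl
  have hm2 : AEMeasurable (fun ω => (‖X ω‖ ^ 2, ‖Y ω‖ ^ 2)) P := hm.comp_aemeasurable hXY
  have hi : Integrable (fun z : ℝ × ℝ => Real.log (1 + γ * z.1) * Real.log (1 + γ * z.2))
      (gammaMixture ‖ρ‖) := by
    rw [← hmap, integrable_map_measure (by fun_prop) hm2]
    exact (memLp_log hγ h.hasLaw_left).integrable_mul (memLp_log hγ hY)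
  have hsum := hasSum_integral_gammaMixture (norm_nonneg ρ) hρ
    (f := fun x => Real.log (1 + γ * x)) (g := fun x => Real.log (1 + γ * x)) hi
  rw [← hmap, integral_map hm2 (by fun_prop)] at hsum
  refine hsum.congr_fun fun t => ?_
  rw [integral_log_gammaMeasure t hγ hR, sisoSeriesTerm, g₂, div_div, mul_comm (1 - ‖ρ‖ ^ 2) γ,
    add_comm 1 t, Nat.cast_one]
  have h2 : Real.exp (2 / (γ * (1 - ‖ρ‖ ^ 2))) = Real.exp (1 / (γ * (1 - ‖ρ‖ ^ 2))) ^ 2 := by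
    rw [← Real.exp_nat_mul]
    congr 1
    push_cast
    ring
  rw [h2]
  simp only [RCLike.ofReal_real_eq_id, id_eq]
  ring

theorem IsCorrelatedPair.integral_log_mul_log [IsProbabilityMeasure P]
    (h : IsCorrelatedPair P X Y ρ)
    (hY : HasLaw Y stdComplexGaussian P) (hγ : 0 < γ) (hρ : ‖ρ‖ ≤ 1) :
    ((∫ ω, Real.log (1 + γ * ‖X ω‖ ^ 2) * Real.log (1 + γ * ‖Y ω‖ ^ 2) ∂P : ℝ) : ℂ) =
      sisoPhi γ ρ := by
  rw [sisoPhi]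
  split_ifs with h0 h1
  · have hs := h.hasSum_integral_log_mul_log hY hγ (h0.trans_lt one_pos)
    -- At `ρ = 0` only `t = 0` survives, with weight `0 ^ 0 = 1`; the product of means remains.
    rw [← hs.tsum_eq, tsum_eq_single 0]
    · simp [sisoSeriesTerm, g₁, g₂, h0]
    · intro t ht
      simp [sisoSeriesTerm, h0, ht]
  · rw [← (h.hasSum_integral_log_mul_log hY hγ h1).tsum_eq, tsum_mul_left]
  -- The independent part of the pair has weight `√(1 - ‖ρ‖²) = 0`, so both coordinates have the
  -- same modulus and the mixed moment is a second moment.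
  · have h2 : ‖ρ‖ = 1 := le_antisymm hρ (not_lt.1 h1)
    rw [sisoMeijerG, (meijerGWellDefined_siso (one_div_pos.2 hγ)).2, ← Complex.ofReal_mul,
      ← integral_log_sq_eq hγ h.hasLaw_left,
      h.integral_comp (f := fun z => Real.log (1 + γ * ‖z.1‖ ^ 2) * Real.log (1 + γ * ‖z.2‖ ^ 2))
        (by
          apply Measurable.stronglyMeasurable
          fun_prop),
      h.integral_comp (f := fun z => Real.log (1 + γ * ‖z.1‖ ^ 2) ^ 2)
        (by
          apply Measurable.stronglyMeasurable
          fun_prop)]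
    congr 2
    ext z
    simp [correlatedPair, h2, sq]

end Pair

/-! ### The subcarriers -/

/-- There are `N - d` pairs at each difference `d`. Symmetry handles `k < l`, so `F` is never needed
at negative differences. The induction adds one row and one column. -/
theorem sum_sum_range_of_symm (N : ℕ) {c : ℕ → ℕ → ℂ} {F : ℕ → ℂ}
    (hsymm : ∀ k l, c k l = c l k) (hc : ∀ l d, c (l + d) l = F d) :
    ∑ k ∈ Finset.range N, ∑ l ∈ Finset.range N, c k l =
      N * F 0 + 2 * ∑ d ∈ Finset.Icc 1 (N - 1), ((N : ℂ) - d) * F d := by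
  have hIcc : ∀ (M : ℕ) (G : ℕ → ℂ), ∑ d ∈ Finset.Icc 1 M, G d =
      ∑ d ∈ Finset.range M, G (d + 1) := fun M G => by
    rw [Finset.range_eq_Ico, Finset.sum_Ico_add' G 0 M 1]
    rfl
  induction N with
  | zero => simp
  | succ N ih =>
    have h1 : ∑ l ∈ Finset.range N, c N l = ∑ d ∈ Finset.Icc 1 N, F d := by
      rw [hIcc, ← Finset.sum_range_reflect]
      refine Finset.sum_congr rfl fun d hd => ?_
      have hd := Finset.mem_range.1 hd
      rw [← hc (N - 1 - d) (d + 1)]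
      congr 1
      omega
    have h2 : ∑ k ∈ Finset.range N, c k N = ∑ d ∈ Finset.Icc 1 N, F d := by
      rw [← h1]
      exact Finset.sum_congr rfl fun k _ => hsymm k N
    -- The extra term `d = N` carries the factor `N - d = 0`.
    have h3 : ∑ d ∈ Finset.Icc 1 N, ((N : ℂ) - d) * F d =
        ∑ d ∈ Finset.Icc 1 (N - 1), ((N : ℂ) - d) * F d := by
      cases N with
      | zero => simp
      | succ M => rw [Finset.sum_Icc_succ_top (by omega)]; simp
    have h4 : ∑ d ∈ Finset.Icc 1 N, ((N + 1 : ℂ) - d) * F d =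
        ∑ d ∈ Finset.Icc 1 N, ((N : ℂ) - d) * F d + ∑ d ∈ Finset.Icc 1 N, F d := by
      rw [← Finset.sum_add_distrib]
      exact Finset.sum_congr rfl fun d _ => by ring
    simp_rw [Finset.sum_range_succ]
    rw [Finset.sum_add_distrib, ih, h1, h2, show c N N = F 0 from hc N 0, Nat.add_sub_cancel]
    push_cast
    rw [h4, h3]
    ring

variable {L : ℕ} (N : ℕ) (σ : Fin L → ℝ)

/-- The coefficient of the `p`-th tap in the `k`-th subcarrier channel. -/
noncomputable def tapCoeff (k : ℕ) (p : Fin L) : ℂ :=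
  (σ p : ℂ) * Complex.exp (-(2 * Real.pi * Complex.I * ((k : ℂ) / N) * (p : ℕ)))

theorem subcarrierChannel_apply {Ω : Type*} (H : Fin L → Ω → Matrix (Fin 1) (Fin 1) ℂ) (k : ℕ)
    (ω : Ω) : subcarrierChannel N σ H k ω 0 0 = ∑ p, tapCoeff N σ k p * H p ω 0 0 := by
  simp [subcarrierChannel, tapCoeff, Matrix.sum_apply]

theorem tapCoeff_eq (k : ℕ) (p : Fin L) : tapCoeff N σ k p =
    σ p * Complex.exp (((-(2 * Real.pi * (k / N) * (p : ℕ)) : ℝ) : ℂ) * Complex.I) := by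
  rw [tapCoeff]
  push_cast
  ring_nf

theorem sum_norm_sq_tapCoeff (k : ℕ) : ∑ p, ‖tapCoeff N σ k p‖ ^ 2 = ∑ p, σ p ^ 2 := by
  refine Finset.sum_congr rfl fun p _ => ?_
  rw [tapCoeff_eq, norm_mul, Complex.norm_exp_ofReal_mul_I, mul_one, Complex.norm_real,
    Real.norm_eq_abs, sq_abs]

/-- Conjugation reverses the phase, so only the difference of the two indices is left. -/
theorem sum_tapCoeff_mul_conj (k l : ℕ) :
    ∑ p, tapCoeff N σ k p * (starRingEnd ℂ) (tapCoeff N σ l p) =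
      freqCorr N σ ((k : ℤ) - (l : ℤ)) := by
  rw [freqCorr]
  refine Finset.sum_congr rfl fun p _ => ?_
  rw [tapCoeff_eq, tapCoeff_eq, map_mul, ← Complex.exp_conj, map_mul, Complex.conj_ofReal,
    Complex.conj_ofReal, Complex.conj_I, mul_mul_mul_comm, ← Complex.exp_add, ← sq]
  congr 2
  push_cast
  ring

theorem norm_freqCorr_le (d : ℤ) : ‖freqCorr N σ d‖ ≤ ∑ p, σ p ^ 2 := by
  refine (norm_sum_le _ _).trans (Finset.sum_le_sum fun p _ => ?_)
  have : (-(2 * Real.pi * Complex.I * (d : ℂ) * (p : ℕ) / N) : ℂ) =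
      ((-(2 * Real.pi * d * (p : ℕ) / N) : ℝ) : ℂ) * Complex.I := by
    push_cast
    ring
  rw [this, norm_mul, Complex.norm_exp_ofReal_mul_I, mul_one, norm_pow, Complex.norm_real,
    Real.norm_eq_abs, sq_abs]

theorem flatMutualInfo_siso (γ : ℝ) (h : Matrix (Fin 1) (Fin 1) ℂ) :
    flatMutualInfo γ h = Real.logb 2 (1 + γ * ‖h 0 0‖ ^ 2) := by
  rw [flatMutualInfo, Matrix.det_unique]
  simp only [Nat.cast_one, div_one, Matrix.add_apply, Matrix.one_apply_eq, Matrix.smul_apply,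
    Matrix.mul_apply, Finset.univ_unique, Finset.sum_singleton, Matrix.conjTranspose_apply,
    smul_eq_mul, RCLike.star_def, Complex.mul_conj', Fin.default_eq_zero]
  norm_cast

theorem ofdmMutualInfo_siso {N : ℕ} {σ : Fin L → ℝ} {Ω : Type*} (γ : ℝ) (H : Fin L → Ω → Matrix (Fin 1) (Fin 1) ℂ) :
    ofdmMutualInfo N γ σ H = fun ω => (1 / ((N : ℝ) * Real.log 2)) *
      ∑ k ∈ Finset.range N, Real.log (1 + γ * ‖subcarrierChannel N σ H k ω 0 0‖ ^ 2) := by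
  ext ω
  simp_rw [ofdmMutualInfo, flatMutualInfo_siso, Real.logb]
  rw [← Finset.sum_div]
  ring

variable {N σ} {Ω : Type*} [MeasurableSpace Ω] {P : Measure Ω} [IsProbabilityMeasure P]
  {H : Fin L → Ω → Matrix (Fin 1) (Fin 1) ℂ}

theorem isCorrelatedPair_subcarriers (hσ : ∑ p, σ p ^ 2 = 1) (hH : IsRayleighFading P H)
    (k l : ℕ) : IsCorrelatedPair P (fun ω => subcarrierChannel N σ H k ω 0 0)
      (fun ω => subcarrierChannel N σ H l ω 0 0) (freqCorr N σ ((k : ℤ) - (l : ℤ))) := by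
  have hlaw : ∀ p, HasLaw (fun ω => H p ω 0 0) stdComplexGaussian P := fun p => hH.hasLaw p 0 0
  have hind : iIndepFun (fun p ω => H p ω 0 0) P :=
    hH.indep.precomp (g := fun p : Fin L => (p, (0 : Fin 1), (0 : Fin 1)))
      (fun a b hab => congrArg Prod.fst hab)
  have hm := fun p => (hlaw p).aemeasurable
  simp_rw [subcarrierChannel_apply]
  refine ⟨by fun_prop, map_pair_eq hlaw hind ?_ ?_ ?_ (sum_tapCoeff_mul_conj N σ k l)⟩
  · rw [sum_norm_sq_tapCoeff, hσ]
  · rw [sum_norm_sq_tapCoeff, hσ]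
  · exact (norm_freqCorr_le N σ _).trans_eq hσ

end OFDM

/-! ### Assembly of the variance formula -/

theorem mainTheorem5 {Ω : Type*} [MeasurableSpace Ω] (P : MeasureTheory.Measure Ω)
    [MeasureTheory.IsProbabilityMeasure P] (N L : ℕ) (hN : 0 < N) (γ : ℝ) (hγ : 0 < γ)
    (σ : Fin L → ℝ) (hσ : ∑ p, σ p ^ 2 = 1)
    (H : Fin L → Ω → Matrix (Fin 1) (Fin 1) ℂ) (hH : OFDM.IsRayleighFading P H) :
    -- `ρ_{k-l}` is the correlation coefficient of the channels on the subcarriers `k` and `l`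
    (∀ k l : ℕ, k < N → l < N →
      ∫ ω, OFDM.subcarrierChannel N σ H k ω 0 0 *
          (starRingEnd ℂ) (OFDM.subcarrierChannel N σ H l ω 0 0) ∂P
        = OFDM.freqCorr N σ ((k : ℤ) - (l : ℤ))) ∧
    -- all the quantities in the formula are well defined
    MeasureTheory.MemLp (OFDM.ofdmMutualInfo N γ σ H) 2 P ∧
    OFDM.MeijerGWellDefined 4 0 ![0, 0, 0] ![0, -1, -1, -1] ((1 / γ : ℝ) : ℂ) ∧
    (∀ d : ℕ, ‖OFDM.freqCorr N σ d‖ ≤ 1) ∧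
    (∀ d : ℕ, 0 < ‖OFDM.freqCorr N σ d‖ → ‖OFDM.freqCorr N σ d‖ < 1 →
      Summable (OFDM.sisoSeriesTerm γ (OFDM.freqCorr N σ d))) ∧
    -- the exact variance
    ((ProbabilityTheory.variance (OFDM.ofdmMutualInfo N γ σ H) P : ℝ) : ℂ) =
      ((Real.logb 2 (Real.exp 1) : ℝ) : ℂ) ^ 2 *
        ((2 / (N : ℂ) ^ 2) * ∑ d ∈ Finset.Icc 1 (N - 1),
            ((N : ℂ) - d) * OFDM.sisoPhi γ (OFDM.freqCorr N σ d)
          + ((2 * Real.exp (1 / γ) / (γ * N) : ℝ) : ℂ) * OFDM.sisoMeijerG γ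
          - ((Real.exp (2 / γ) * OFDM.g₁ 1 γ 1 ^ 2 : ℝ) : ℂ)) := by
  have hpair := fun k l => OFDM.isCorrelatedPair_subcarriers (N := N) hσ hH k l
  have hlaw := fun k => (hpair k 0).hasLaw_left
  have hle : ∀ d : ℤ, ‖OFDM.freqCorr N σ d‖ ≤ 1 := fun d =>
    (OFDM.norm_freqCorr_le N σ d).trans_eq hσ
  have hγ' : 0 < 1 / γ := one_div_pos.2 hγ
  set I : ℕ → Ω → ℝ := fun k ω =>
    Real.log (1 + γ * ‖OFDM.subcarrierChannel N σ H k ω 0 0‖ ^ 2) with hI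
  have hmem : ∀ k, MemLp (I k) 2 P := fun k => OFDM.memLp_log hγ (hlaw k)
  have hofdm : OFDM.ofdmMutualInfo N γ σ H =
      fun ω => (1 / ((N : ℝ) * Real.log 2)) * ∑ k ∈ Finset.range N, I k ω :=
    OFDM.ofdmMutualInfo_siso γ H
  have hmemS : MemLp (fun ω => ∑ k ∈ Finset.range N, I k ω) 2 P :=
    memLp_finsetSum _ fun k _ => hmem k
  refine ⟨fun k l _ _ => (hpair k l).integral_mul_conj, ?_,
    (OFDM.meijerGWellDefined_siso hγ').1, fun d => hle d, fun d _ h1 => ?_, ?_⟩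
  · rw [hofdm]
    exact hmemS.const_mul _
  -- `ρ_d` is the correlation of the channels at indices `d` and `0`, so the series is that of an
  -- actual mixed moment, up to a positive factor. The index `d` need not be below `N`.
  · have h := ((hpair d 0).hasSum_integral_log_mul_log (hlaw 0) hγ (by simpa using h1)).summable
    have hq := OFDM.one_sub_sq_pos (norm_nonneg _) h1
    simp only [Nat.cast_zero, sub_zero] at h
    exact (summable_mul_left_iff (by positivity)).1 h
  · have hN0 : (N : ℂ) ≠ 0 := by exact_mod_cast hN.ne'
    have hlog : Real.log 2 ≠ 0 := (Real.log_pos one_lt_two).ne'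
    have hlogc : ((Real.log 2 : ℝ) : ℂ) ≠ 0 := by exact_mod_cast hlog
    have hM : ∀ k l, ((∫ ω, I k ω * I l ω ∂P : ℝ) : ℂ) =
        OFDM.sisoPhi γ (OFDM.freqCorr N σ ((k : ℤ) - (l : ℤ))) := fun k l =>
      (hpair k l).integral_log_mul_log (hlaw l) hγ (hle _)
    have hmul : ∀ k l, Integrable (fun ω => I k ω * I l ω) P := fun k l =>
      (hmem k).integrable_mul (hmem l)
    have hvar : variance (fun ω => ∑ k ∈ Finset.range N, I k ω) P =
        (∑ k ∈ Finset.range N, ∑ l ∈ Finset.range N, ∫ ω, I k ω * I l ω ∂P) -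
          (N * (Real.exp (1 / γ) * OFDM.g₁ 1 γ 1)) ^ 2 := by
      rw [variance_eq_sub hmemS]
      congr 1
      · simp only [Pi.pow_apply, sq, Finset.sum_mul_sum]
        rw [integral_finsetSum _ fun k _ => integrable_finsetSum _ fun l _ =>
          hmul k l]
        refine Finset.sum_congr rfl fun k _ => ?_
        rw [integral_finsetSum _ fun l _ => hmul k l]
      · rw [integral_finsetSum _ fun k _ => (hmem k).integrable (by norm_num)]
        simp_rw [hI, OFDM.integral_log_eq hγ (hlaw _)]
        simp
    have hsum := OFDM.sum_sum_range_of_symm N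
      (c := fun k l => ((∫ ω, I k ω * I l ω ∂P : ℝ) : ℂ))
      (F := fun d => OFDM.sisoPhi γ (OFDM.freqCorr N σ d))
      (fun k l => by simp only [mul_comm]) (fun l d => by rw [hM]; simp)
    -- The diagonal terms fall in the branch `|ρ| = 1`, since `ρ_0 = ∑ σ_p² = 1`; they produce the
    -- separate Meijer term.
    have hF0 : OFDM.sisoPhi γ (OFDM.freqCorr N σ (0 : ℕ)) =
        ((2 * Real.exp (1 / γ) / γ : ℝ) : ℂ) * OFDM.sisoMeijerG γ := by
      have h1 : OFDM.freqCorr N σ (0 : ℕ) = 1 := by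
        simp only [OFDM.freqCorr]
        simp [← Complex.ofReal_pow, ← Complex.ofReal_sum, hσ]
      rw [h1]
      simp [OFDM.sisoPhi]
    have hexp : Real.exp (2 / γ) = Real.exp (1 / γ) ^ 2 := by
      rw [← Real.exp_nat_mul]
      congr 1
      push_cast
      ring
    rw [hofdm, variance_const_mul, hvar, Real.logb, Real.log_exp, hexp]
    push_cast at hsum hF0 ⊢
    rw [hsum, hF0]
    field_simp
    ring
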